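/- Let $\Omega\subset\mathbb{C}^{n+1}$ be a bounded strongly pseudoconvex domain with $C^\infty$ boundary $M=\partial\Omega$, and let $\gamma$ be a $C^\infty$ defining function: $\gamma$ is real valued and smooth near $M$, with $M=\{\gamma=0\}$ and $\Omega=\{\gamma<0\}$ near $M$, $d\gamma\neq 0$ on $M$, and $\sum\gamma_{j\bar k}v^j\bar v^k>0$ for $0\ne v\in\xi_p$, $p\in M$, where $\xi=TM\cap J\,TM$ and $J$ is multiplication by $i$. Put $\theta=-i\,\partial\gamma$. Locally near $M$ choose type $(1,0)$ forms $\theta^\alpha$ ($\alpha=1,\dots,n$), independent together with $\theta$, such that at the points of $M$ $$d\theta=i h_{\alpha\bar\beta}\,\theta^\alpha\wedge\theta^{\bar\beta}+\rho\,\theta\wedge\bar\theta ,$$ and let $i\zeta, Z_\alpha$ be the dual type $(1,0)$ vector fields. The connection forms $\omega_\beta{}^\alpha$ and the torsion $A_{\bar\beta}{}^{\alpha}$ of the pseudohermitian structure $(J,\theta)$ are determined on $M$ by $$d\theta^\alpha=\theta^\beta\wedge\omega_\beta{}^\alpha+A_{\bar\beta}{}^{\alpha}\,\theta\wedge\theta^{\bar\beta},\qquad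 dh_{\alpha\bar\beta}=h_{\mu\bar\beta}\,\omega_\alpha{}^\mu+h_{\alpha\bar\mu}\,\omega_{\bar\beta}{}^{\bar\mu}.$$ Indices after a comma denote covariant derivatives, so that $f_{,\bar\alpha}=Z_{\bar\alpha}f$ and $f_{,\bar\alpha\bar\mu}=Z_{\bar\mu}Z_{\bar\alpha}f-\omega_{\bar\alpha}{}^{\bar\kappa}(Z_{\bar\mu})Z_{\bar\kappa}f$; indices are raised by $h^{\beta\bar\mu}$, where $h_{\alpha\bar\mu}h^{\beta\bar\mu}=\delta_\alpha^\beta$. For $f\in C^\infty(M,\mathbb{C})$ put $$\mathfrak{D}_Jf=\bigl(f_{,\bar\alpha}{}^{\beta}-iA_{\bar\alpha}{}^{\beta}f\bigr)\,\theta^{\bar\alpha}\otimes Z_\beta,\qquad Y_f=i\,(f\zeta+f^{,\alpha}Z_\alpha),\qquad \chi_f(p)=p+Y_f(p)\quad(p\in M);$$ these do not depend on the choice of the $\theta^\alpha$, and $Y_f$, with values in $T_{1,0}\mathbb{C}^{n+1}$, is regarded as a $\mathbb{C}^{n+1}$-valued function on $M$. A smooth map $\varphi:M\to\mathbb{C}^{n+1}$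 is CR if $d\varphi\circ J=i\,d\varphi$ on $\xi$; a CR embedding is a CR map that is an immersion and a homeomorphism onto its image. Then: 1. The map $f\mapsto\chi_f$ is a bijection from $\operatorname{Ker}\mathfrak{D}_J\subset C^\infty(M,\mathbb{C})$ onto the set of all smooth CR maps $(M,\xi,J)\to\mathbb{C}^{n+1}$. 2. Under this bijection the small $f$ correspond to the CR embeddings near the inclusion $i_M:M\to\mathbb{C}^{n+1}$. That is, in the $C^\infty$ topology: for every neighbourhood $\mathcal{V}$ of $i_M$ there is a neighbourhood $\mathcal{U}$ of $0$ such that, for each $f\in\operatorname{Ker}\mathfrak{D}_J\cap\mathcal{U}$, the map $\chi_f$ is a CR embedding and lies in $\mathcal{V}$; and for every neighbourhood $\mathcal{U}$ of $0$ there is a neighbourhood $\mathcal{V}$ of $i_M$ such that each CR embedding $\varphi\in\mathcal{V}$ equals $\chi_f$ for some $f\in\operatorname{Ker}\mathfrak{D}_J\cap\mathcal{U}$. -/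

import Mathlib

open scoped ContDiff

noncomputable section

namespace PseudoHermitian

/-- The space `ℂ^{n+1}` with its Euclidean norm. -/
abbrev Cn (n : ℕ) : Type := EuclideanSpace ℂ (Fin (n + 1))

/-! ### Functions on a subset `M` of `ℂ^{n+1}` -/

section Functions

variable {n : ℕ} {F : Type} [NormedAddCommGroup F] [NormedSpace ℝ F]

/-- A function on `M` is `C^∞` if near each point of `M` it is the restriction of a `C^∞` function
defined on an open subset of `ℂ^{n+1}`. -/
def IsSmooth (M : Set (Cn n)) (f : M → F) : Prop :=
  ∀ p : M, ∃ W : Set (Cn n), IsOpen W ∧ (p : Cn n) ∈ W ∧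
    ∃ g : Cn n → F, ContDiffOn ℝ ∞ g W ∧ ∀ q : M, (q : Cn n) ∈ W → g q = f q

/-- Extension of a function on `M` by `0`. It only serves to apply `fderivWithin ℝ · M`, which does
not see the values off `M`. -/
def ext0 (M : Set (Cn n)) (f : M → F) : Cn n → F :=
  Function.extend Subtype.val f 0

/-- The derivative `df_p(v)` of a function on `M` in the direction of a vector `v` tangent to `M` at
`p ∈ M`. For `f` differentiable on `M`, the value of `fderivWithin ℝ f M p` on vectors that are
tangent to `M` does not depend on the choice involved in `fderivWithin`. -/
def tderiv (M : Set (Cn n)) (f : Cn n → F) (p v : Cn n) : F :=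
  fderivWithin ℝ f M p v

/-- `f` is small in the `C^k` sense on the compact submanifold `M`: some `C^∞` extension of `f` to a
neighbourhood of `M` has all derivatives of order at most `k` smaller than `ε` at the points of `M`.
For varying `k` and `ε` these are a basis of neighbourhoods of `0` in the `C^∞` topology. -/
def IsCkSmall (M : Set (Cn n)) (k : ℕ) (ε : ℝ) (f : M → F) : Prop :=
  ∃ W : Set (Cn n), IsOpen W ∧ M ⊆ W ∧ ∃ g : Cn n → F, ContDiffOn ℝ ∞ g W ∧
    (∀ q : M, g q = f q) ∧ ∀ q : M, ∀ j ≤ k, ‖iteratedFDeriv ℝ j g q‖ < ε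

end Functions

/-! ### Forms on `ℂ^{n+1}` and complex vector fields

A type `(1,0)` vector `∑ z^j ∂/∂z^j` is represented by `z : Cn n`; as a complexified real vector it
is `(z - i J z) / 2`, and its conjugate, of type `(0,1)`, is `(z + i J z) / 2`. -/

section Forms

variable {n : ℕ}

/-- Value at `p` of the derivative of `f : M → ℂ` along the `(0,1)` vector conjugate to `z`. -/
def dbar (M : Set (Cn n)) (f : Cn n → ℂ) (p z : Cn n) : ℂ :=
  (1 / 2) * (tderiv M f p z + Complex.I * tderiv M f p (Complex.I • z))

/-- The value of a complex valued covector on the type `(1,0)` vector represented by `z`. -/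
def eval10 (a : Cn n →L[ℝ] ℂ) (z : Cn n) : ℂ :=
  (1 / 2) * (a z - Complex.I * a (Complex.I • z))

/-- `(a ∧ b)(u, v)`. -/
def wedge (a b : Cn n →L[ℝ] ℂ) (u v : Cn n) : ℂ := a u * b v - a v * b u

/-- The complex conjugate of a complex valued covector. -/
def conjForm (a : Cn n →L[ℝ] ℂ) : Cn n →L[ℝ] ℂ :=
  (Complex.conjCLE : ℂ →L[ℝ] ℂ).comp a

/-- The exterior derivative of a complex valued 1-form: `(da)_p(u, v)`. -/
def dForm (a : Cn n → (Cn n →L[ℝ] ℂ)) (p u v : Cn n) : ℂ :=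
  fderiv ℝ a p u v - fderiv ℝ a p v u

/-- The form `∂γ = ∑ (∂γ/∂z^j) dz^j` of a real valued function, `∂γ(v) = (dγ(v) - i dγ(iv)) / 2`. -/
def del (γ : Cn n → ℝ) (p : Cn n) : Cn n →L[ℝ] ℂ :=
  (1 / 2 : ℂ) • (Complex.ofRealCLM.comp (fderiv ℝ γ p)
    - Complex.I • (Complex.ofRealCLM.comp (fderiv ℝ γ p)).comp
        (Complex.I • ContinuousLinearMap.id ℝ (Cn n)))

/-- The form `θ = -i ∂γ`. -/
def contactForm (γ : Cn n → ℝ) (p : Cn n) : Cn n →L[ℝ] ℂ := (-Complex.I) • del γ p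

/-- The Levi form `∑ γ_{j k̄} v^j v̄^k` of `γ`, in terms of the real Hessian. -/
def leviForm (γ : Cn n → ℝ) (p v : Cn n) : ℝ :=
  (1 / 4) * (fderiv ℝ (fderiv ℝ γ) p v v
    + fderiv ℝ (fderiv ℝ γ) p (Complex.I • v) (Complex.I • v))

/-- The tangent space at `p` of the hypersurface `γ = 0`. -/
def tangent (γ : Cn n → ℝ) (p : Cn n) : Set (Cn n) := {v | fderiv ℝ γ p v = 0}

/-- The contact space `ξ_p = T_p M ∩ J T_p M`, on which the CR structure `J` is multiplication
by `i`. -/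
def contactSpace (γ : Cn n → ℝ) (p : Cn n) : Set (Cn n) :=
  {v | v ∈ tangent γ p ∧ Complex.I • v ∈ tangent γ p}

end Forms

/-- `Ω` is a bounded strongly pseudoconvex domain with smooth boundary, and `γ` is a defining
function of its boundary: `γ` is smooth on a neighbourhood `V` of the boundary, in which the boundary
is `γ = 0` and `Ω` is `γ < 0`; also `dγ ≠ 0` on the boundary, and there the Levi form is positive
definite on the contact spaces. -/
structure IsStronglyPseudoconvex {n : ℕ} (Ω V : Set (Cn n)) (γ : Cn n → ℝ) : Prop where
  isOpen : IsOpen Ω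
  isConnected : IsConnected Ω
  isBounded : Bornology.IsBounded Ω
  isOpen_nhd : IsOpen V
  smooth : ContDiffOn ℝ ∞ γ V
  frontier_eq : frontier Ω = {p | p ∈ V ∧ γ p = 0}
  inside : Ω ∩ V = {p | p ∈ V ∧ γ p < 0}
  regular : ∀ p ∈ frontier Ω, fderiv ℝ γ p ≠ 0
  levi_pos : ∀ p ∈ frontier Ω, ∀ v ∈ contactSpace γ p, v ≠ 0 → 0 < leviForm γ p v

/-- A local frame for the pseudohermitian structure `(J, θ)`, `θ = -i ∂γ`, on the hypersurface `M`,
with its connection forms and torsion. The type `(1,0)` forms `θ^α` live on an open set `U` of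
`ℂ^{n+1}`; `iζ, Z_α` is the frame of type `(1,0)` vector fields dual to `θ, θ^α`. The matrix `h`, the
forms `conn β α = ω_β^α` and the functions `A α β = A^α_{β̄}` are uniquely determined along `M` (the
forms `conn` on vectors tangent to `M`) by the equations below, hence are smooth there. -/
structure LocalFrame {n : ℕ} (M : Set (Cn n)) (γ : Cn n → ℝ) where
  U : Set (Cn n)
  isOpen : IsOpen U
  θ : Fin n → Cn n → (Cn n →L[ℝ] ℂ)
  smooth : ∀ α, ContDiffOn ℝ ∞ (θ α) U
  type10 : ∀ α, ∀ p ∈ U, ∀ v, θ α p (Complex.I • v) = Complex.I * θ α p v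
  ζ : Cn n → Cn n
  Z : Fin n → Cn n → Cn n
  contactForm_ζ : ∀ p ∈ U, contactForm γ p (Complex.I • ζ p) = 1
  θ_ζ : ∀ α, ∀ p ∈ U, θ α p (Complex.I • ζ p) = 0
  contactForm_Z : ∀ α, ∀ p ∈ U, contactForm γ p (Z α p) = 0
  θ_Z : ∀ α β, ∀ p ∈ U, θ α p (Z β p) = if α = β then 1 else 0
  h : Cn n → Matrix (Fin n) (Fin n) ℂ
  conn : Fin n → Fin n → Cn n → (Cn n →L[ℝ] ℂ)
  A : Fin n → Fin n → Cn n → ℂ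
  /-- `dθ = i h_{αβ̄} θ^α ∧ θ^β̄ + ρ θ ∧ θ̄` at the points of `M`. -/
  levi : ∀ p ∈ M ∩ U, ∃ ρ : ℂ, ∀ u v,
    dForm (contactForm γ) p u v =
      (∑ α, ∑ β, Complex.I * h p α β * wedge (θ α p) (conjForm (θ β p)) u v)
        + ρ * wedge (contactForm γ p) (conjForm (contactForm γ p)) u v
  /-- `dθ^α = θ^β ∧ ω_β^α + A^α_{β̄} θ ∧ θ^β̄` on `TM`. -/
  structure_eq : ∀ α, ∀ p ∈ M ∩ U, ∀ u ∈ tangent γ p, ∀ v ∈ tangent γ p,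
    dForm (θ α) p u v =
      (∑ β, wedge (θ β p) (conn β α p) u v)
        + ∑ β, A α β p * wedge (contactForm γ p) (conjForm (θ β p)) u v
  /-- `dh_{αβ̄} = h_{μβ̄} ω_α^μ + h_{αμ̄} ω_β̄^μ̄` on `TM`. -/
  metric_compat : ∀ α β, ∀ p ∈ M ∩ U, ∀ v ∈ tangent γ p,
    tderiv M (fun q => h q α β) p v =
      ∑ μ, (h p μ β * conn α μ p v + h p α μ * conjForm (conn β μ p) v)

namespace LocalFrame

variable {n : ℕ} {M : Set (Cn n)} {γ : Cn n → ℝ} (E : LocalFrame M γ)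

/-- The inverse matrix `h^{βμ̄}`, for which `h_{αμ̄} h^{βμ̄} = δ_α^β`. -/
def hInv (p : Cn n) (β μ : Fin n) : ℂ := (E.h p)⁻¹ μ β

/-- The covariant derivative `f_{,ᾱ} = Z_ᾱ f`. -/
def cov1 (f : Cn n → ℂ) (α : Fin n) (p : Cn n) : ℂ := dbar M f p (E.Z α p)

/-- The second covariant derivative `f_{,ᾱμ̄} = Z_μ̄ Z_ᾱ f - ω_ᾱ^κ̄(Z_μ̄) Z_κ̄ f`. -/
def cov2 (f : Cn n → ℂ) (α μ : Fin n) (p : Cn n) : ℂ :=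
  dbar M (E.cov1 f α) p (E.Z μ p)
    - ∑ κ, (starRingEnd ℂ) (eval10 (E.conn α κ p) (E.Z μ p)) * E.cov1 f κ p

/-- `f^{,β} = h^{βμ̄} f_{,μ̄}`. -/
def grad (f : Cn n → ℂ) (β : Fin n) (p : Cn n) : ℂ := ∑ μ, E.hInv p β μ * E.cov1 f μ p

/-- The component `f_{,ᾱ}^β - i A_ᾱ^β f` of `𝔇_J f` along `θ^ᾱ ⊗ Z_β`. -/
def DJ (f : Cn n → ℂ) (α β : Fin n) (p : Cn n) : ℂ :=
  (∑ μ, E.hInv p β μ * E.cov2 f α μ p) - Complex.I * E.A β α p * f p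

/-- The type `(1,0)` vector `Y_f = i (f ζ + f^{,α} Z_α)`, computed in the frame. -/
def Y (f : Cn n → ℂ) (p : Cn n) : Cn n :=
  Complex.I • (f p • E.ζ p + ∑ α, E.grad f α p • E.Z α p)

end LocalFrame

variable {n : ℕ}

/-- The kernel of `𝔇_J` in `C^∞(M, ℂ)`: all components of `𝔇_J f` in all local frames vanish. -/
def kerDJ (M : Set (Cn n)) (γ : Cn n → ℝ) : Set (M → ℂ) :=
  {f | IsSmooth M f ∧ ∀ (E : LocalFrame M γ), ∀ p ∈ M ∩ E.U, ∀ α β, E.DJ (ext0 M f) α β p = 0}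

open Classical in
/-- The vector field `Y_f` along `M`, with values in `T_{1,0} ℂ^{n+1}`. At each point it is computed
in a local frame around the point; the value does not depend on the frame. -/
def contactField (M : Set (Cn n)) (γ : Cn n → ℝ) (f : M → ℂ) (p : M) : Cn n :=
  if H : ∃ E : LocalFrame M γ, (p : Cn n) ∈ E.U then H.choose.Y (ext0 M f) p else 0

/-- The map `χ_f : M → ℂ^{n+1}`, `χ_f(p) = p + Y_f(p)`. -/
def chi (M : Set (Cn n)) (γ : Cn n → ℝ) (f : M → ℂ) (p : M) : Cn n :=
  (p : Cn n) + contactField M γ f p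

/-- The smooth CR maps `(M, ξ, J) → ℂ^{n+1}`: the differential is complex linear on `ξ`. -/
def CRMaps (M : Set (Cn n)) (γ : Cn n → ℝ) : Set (M → Cn n) :=
  {φ | IsSmooth M φ ∧ ∀ p ∈ M, ∀ v ∈ contactSpace γ p,
    tderiv M (ext0 M φ) p (Complex.I • v) = Complex.I • tderiv M (ext0 M φ) p v}

/-- The CR embeddings: CR maps that are immersions and homeomorphisms onto their image. -/
def CREmbeddings (M : Set (Cn n)) (γ : Cn n → ℝ) : Set (M → Cn n) :=
  {φ | φ ∈ CRMaps M γ ∧ Topology.IsEmbedding φ ∧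
    ∀ p ∈ M, ∀ v ∈ tangent γ p, tderiv M (ext0 M φ) p v = 0 → v = 0}

end PseudoHermitian

end

/-!
The differential of `γ` enters through the `(1,0)` form `θ = -i ∂γ` and the sesquilinear Levi form
`L(u, v) = ∑ γ_{j k̄} u^j v̄^k`, which satisfies `∂_v̄ θ(u) = -i L(u, v)`. The vector `y = Y_f(p)`
is characterized without a frame by `θ(y) = f(p)` and `L(y, w) = i (∂̄f)(w̄)` for all `w` in the
contact space `ξ_p = ker θ` (`IsContactLift`); it is unique because `L` is definite on `ξ_p`. In
particular `f = θ(Y_f)`, so `f ↦ χ_f` is injective.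

Let `φ = id + Y` be CR, that is, `∂̄_b Y = 0`, and put `f = θ(Y)`. Differentiating `θ(Y)` along
`w̄ ∈ ξ^{0,1}` gives `∂̄f(w̄) = -i L(Y, w) + θ(∂_w̄ Y)`, whose last term vanishes, so `Y = Y_f`.
For an arbitrary `f` the same identity shows that `∂̄_b Y_f` takes values in `ker θ`.
Differentiating the components `θ^α(Y_f)` and using the structure equations one finds that `𝔇_J f`
is `∂̄_b Y_f` with indices moved by `L` (`LocalFrame.DJ_eq`), hence `𝔇_J f = 0` if and only if
`χ_f` is CR (`LocalFrame.DJ_eq_zero_iff`). This computation needs the symmetry of the torsion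
`A_{ᾱβ̄}`, which is seen from an expression of `A` by third derivatives of `γ`
(`LocalFrame.sum_h_mul_A`); it is obtained by differentiating `L(iζ, Z_μ) = 0` along `M`.

Local frames exist near every point of `M`: take forms `θ^α = L(·, X_α)` for a frame `X_α` of `ker
θ` (`exists_isAdaptedFrame`). The connection is then the Chern connection of `L` corrected by a
multiple of `θ`, and the structure equations and the compatibility with `h` are verified by hand
(`IsAdaptedFrame.structure_eq`, `IsAdaptedFrame.metric_compat`).

For the statements about neighbourhoods, the characterization of `Y_f` is a linear system with
smooth coefficients, so that `Y_f = S₀ f + S₁ df` with smooth `S₀`, `S₁` near `M`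
(`exists_lift_operator`). As `M` is compact, the `C^k` size of `Y_f` is bounded by the `C^{k+1}`
size of `f`, and that of `f = θ(Y_f)` by the `C^k` size of `Y_f`. Finally, a map `Y` with small
`C^1` size on `M` has a small Lipschitz constant on `M` (`exists_lipschitz`), and then `id + Y` is
an injective immersion of a compact space, hence an embedding.
-/

noncomputable section

namespace PseudoHermitian
open Filter Topology

/-! ### Calculus on a regular hypersurface -/

/-- A regular level set can be straightened: near `p` there is a local diffeomorphism `Θ`, tangent
to the identity at `p`, that carries the affine hyperplane `dγ_p (y - p) = 0` to `γ = 0`; `Φ` is its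
inverse. -/
theorem exists_straightening {E : Type*} [NormedAddCommGroup E] [NormedSpace ℝ E]
    [CompleteSpace E] {γ : E → ℝ} {p : E} (hγ : ContDiffAt ℝ ∞ γ p) (h0 : γ p = 0)
    (hd : fderiv ℝ γ p ≠ 0) :
    ∃ Θ Φ : E → E, ContDiffAt ℝ ∞ Θ p ∧ HasStrictFDerivAt Θ (ContinuousLinearMap.id ℝ E) p ∧
      HasStrictFDerivAt Φ (ContinuousLinearMap.id ℝ E) p ∧ Θ p = p ∧ Φ p = p ∧
      (∀ᶠ y in 𝓝 p, γ (Θ y) = fderiv ℝ γ p (y - p)) ∧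
      (∀ᶠ x in 𝓝 p, Θ (Φ x) = x) ∧ ∀ x, fderiv ℝ γ p (Φ x - p) = γ x := by
  obtain ⟨w, hw⟩ : ∃ w, fderiv ℝ γ p w = 1 := by
    obtain ⟨v, hv⟩ : ∃ v, fderiv ℝ γ p v ≠ 0 := by
      by_contra! h
      exact hd (ContinuousLinearMap.ext h)
    exact ⟨(fderiv ℝ γ p v)⁻¹ • v, by simp [hv]⟩
  set L := fderiv ℝ γ p with hL
  -- the correction along `w` makes `γ` the linear coordinate `dγ_p (Φ x - p)`
  set Φ : E → E := fun x => x + (γ x - L (x - p)) • w with hΦ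
  have hΦp : Φ p = p := by simp [hΦ, h0]
  have hΦL : ∀ x, L (Φ x - p) = γ x := by
    intro x
    simp only [hΦ, map_sub, map_add, map_smul, hw, smul_eq_mul]
    ring
  have hc : ContDiffAt ℝ ∞ Φ p := by
    have : ContDiffAt ℝ ∞ (fun x => L (x - p)) p := by fun_prop
    exact contDiffAt_id.add ((hγ.sub this).smul contDiffAt_const)
  have hs : HasFDerivAt Φ ((ContinuousLinearEquiv.refl ℝ E : E ≃L[ℝ] E) : E →L[ℝ] E) p := by
    have h1 : HasFDerivAt γ L p := (hγ.differentiableAt (by simp)).hasFDerivAt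
    have h2 : HasFDerivAt (fun x => L (x - p)) L p :=
      L.hasFDerivAt.comp p ((hasFDerivAt_id p).sub_const p)
    have := (hasFDerivAt_id p).add ((h1.sub h2).smul_const w)
    refine this.congr_fderiv ?_
    ext x
    simp
  have hs' := hc.hasStrictFDerivAt' hs (by simp)
  refine ⟨hc.localInverse hs (by simp), Φ, ?_, ?_, by simpa using! hs', ?_, hΦp, ?_, ?_, ?_⟩
  · simpa [hΦp] using hc.to_localInverse hs (by simp)
  · have := hs'.to_localInverse
    rw [hΦp] at this
    simpa using! this
  · have := hs'.localInverse_apply_image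
    rw [hΦp] at this
    exact this
  · have := hs'.eventually_right_inverse
    rw [hΦp] at this
    filter_upwards [this] with y hy
    have h2 : L (Φ (HasStrictFDerivAt.localInverse Φ _ p hs' y) - p) = L (y - p) := by rw [hy]
    rw [← h2]
    exact (hΦL _).symm
  · exact hs'.eventually_left_inverse
  · exact hΦL

/-- The compact hypersurface `M = {γ = 0}` with positive definite Levi form, with `γ` smooth on the
neighbourhood `V` of `M`. -/
structure IsLeviHypersurface {n : ℕ} (M V : Set (Cn n)) (γ : Cn n → ℝ) : Prop where
  isCompact : IsCompact M
  isOpen : IsOpen V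
  smooth : ContDiffOn ℝ ∞ γ V
  eq_zeros : M = {p | p ∈ V ∧ γ p = 0}
  regular : ∀ p ∈ M, fderiv ℝ γ p ≠ 0
  levi_pos : ∀ p ∈ M, ∀ v ∈ contactSpace γ p, v ≠ 0 → 0 < leviForm γ p v

theorem IsStronglyPseudoconvex.isLeviHypersurface {n : ℕ} {Ω V : Set (Cn n)} {γ : Cn n → ℝ}
    (h : IsStronglyPseudoconvex Ω V γ) : IsLeviHypersurface (frontier Ω) V γ where
  isCompact := Metric.isCompact_of_isClosed_isBounded isClosed_frontier
    (h.isBounded.closure.subset frontier_subset_closure)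
  isOpen := h.isOpen_nhd
  smooth := h.smooth
  eq_zeros := h.frontier_eq
  regular := h.regular
  levi_pos := h.levi_pos

namespace IsLeviHypersurface

variable {n : ℕ} {M V : Set (Cn n)} {γ : Cn n → ℝ} (hM : IsLeviHypersurface M V γ)
  {F : Type} [NormedAddCommGroup F] [NormedSpace ℝ F]
include hM

theorem subset : M ⊆ V := by
  intro p hp
  rw [hM.eq_zeros] at hp
  exact hp.1

theorem eq_zero {p : Cn n} (hp : p ∈ M) : γ p = 0 := by
  rw [hM.eq_zeros] at hp
  exact hp.2

theorem contDiffAt {p : Cn n} (hp : p ∈ V) : ContDiffAt ℝ ∞ γ p :=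
  hM.smooth.contDiffAt (hM.isOpen.mem_nhds hp)

theorem tangent_subset_tangentConeAt {p : Cn n} (hp : p ∈ M) :
    tangent γ p ⊆ tangentConeAt ℝ M p := by
  intro v hv
  obtain ⟨Θ, Φ, -, h1, -, h2, -, h3, -, -⟩ :=
    exists_straightening (hM.contDiffAt (hM.subset hp)) (hM.eq_zero hp) (hM.regular p hp)
  have hc : ContinuousAt (fun t : ℝ => p + t • v) 0 := by fun_prop
  have hl : HasFDerivAt (fun t : ℝ => p + t • v)
      ((ContinuousLinearMap.id ℝ ℝ).smulRight v) 0 :=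
    ((hasFDerivAt_id (0 : ℝ)).smul_const v).const_add p
  have hΘ : HasFDerivAt Θ (ContinuousLinearMap.id ℝ (Cn n)) (p + (0 : ℝ) • v) := by
    simpa using h1.hasFDerivAt
  have hcomp := hΘ.comp (0 : ℝ) hl
  have hV : ∀ᶠ y in 𝓝 p, Θ y ∈ V := by
    apply h1.hasFDerivAt.continuousAt
    rw [h2]
    exact hM.isOpen.mem_nhds (hM.subset hp)
  have ht : Tendsto (fun t : ℝ => p + t • v) (𝓝 0) (𝓝 p) := by
    simpa using hc.tendsto
  set S : Set ℝ := {t | Θ (p + t • v) ∈ M} with hS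
  have hSn : S ∈ 𝓝 (0 : ℝ) := by
    filter_upwards [ht.eventually hV, ht.eventually h3] with t h4 h5
    simp only [hS, Set.mem_ofPred_eq]
    rw [hM.eq_zeros]
    refine ⟨h4, ?_⟩
    have hv' : fderiv ℝ γ p v = 0 := hv
    rw [h5]
    simp [hv']
  have := (hcomp.hasFDerivWithinAt (s := S)).mapsTo_tangent_cone
  have h1' : (1 : ℝ) ∈ tangentConeAt ℝ S 0 := by
    rw [tangentConeAt_of_mem_nhds hSn]
    trivial
  have h6 := this h1'
  have h7 : tangentConeAt ℝ ((Θ ∘ fun t : ℝ => p + t • v) '' S)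
      ((Θ ∘ fun t : ℝ => p + t • v) 0) ⊆ tangentConeAt ℝ M p := by
    have : (Θ ∘ fun t : ℝ => p + t • v) 0 = p := by simp [h2]
    rw [this]
    apply tangentConeAt_mono
    rintro _ ⟨t, ht, rfl⟩
    exact ht
  simpa using h7 h6

theorem tderiv_eq_of_hasFDerivWithinAt {p : Cn n} (hp : p ∈ M) {f : Cn n → F}
    {f' : Cn n →L[ℝ] F} (hf : HasFDerivWithinAt f f' M p) {v : Cn n} (hv : v ∈ tangent γ p) :
    tderiv M f p v = f' v :=
  hf.differentiableWithinAt.hasFDerivWithinAt.unique_on hf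
    (hM.tangent_subset_tangentConeAt hp hv)

/-- The derivative along `M` may be computed with any differentiable extension. -/
theorem tderiv_eq {p : Cn n} (hp : p ∈ M) {f g : Cn n → F} (hg : DifferentiableAt ℝ g p)
    (h : ∀ᶠ q in 𝓝 p, q ∈ M → f q = g q) {v : Cn n} (hv : v ∈ tangent γ p) :
    tderiv M f p v = fderiv ℝ g p v := by
  refine hM.tderiv_eq_of_hasFDerivWithinAt hp ?_ hv
  refine hg.hasFDerivAt.hasFDerivWithinAt.congr_of_eventuallyEq ?_ (h.self_of_nhds hp)
  rw [EventuallyEq, eventually_nhdsWithin_iff]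
  exact h

theorem fderiv_eq_of_eqOn {p : Cn n} (hp : p ∈ M) {f g : Cn n → F} (hf : DifferentiableAt ℝ f p)
    (hg : DifferentiableAt ℝ g p) (h : ∀ᶠ q in 𝓝 p, q ∈ M → f q = g q) {v : Cn n}
    (hv : v ∈ tangent γ p) : fderiv ℝ f p v = fderiv ℝ g p v := by
  rw [← hM.tderiv_eq hp hg h hv,
    ← hM.tderiv_eq hp hf (f := f) (Eventually.of_forall fun _ _ => rfl) hv]

/-- Near each of its points `M` is the bi-Lipschitz image of a convex set in a hyperplane, hence
bounds of a derivative at the points of `M` give Lipschitz bounds on `M`. -/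
theorem exists_local_lipschitz {p : Cn n} (hp : p ∈ M) :
    ∃ t ∈ 𝓝 p, ∀ g : Cn n → F, (∀ q ∈ M, DifferentiableAt ℝ g q) → ∀ ε : ℝ,
      (∀ q ∈ M, ‖fderiv ℝ g q‖ ≤ ε) →
        ∀ q ∈ M ∩ t, ∀ q' ∈ M ∩ t, ‖g q - g q'‖ ≤ 4 * ε * ‖q - q'‖ := by
  obtain ⟨Θ, Φ, hc, h1, h1', h2, h2', h3, h4, h5⟩ :=
    exists_straightening (hM.contDiffAt (hM.subset hp)) (hM.eq_zero hp) (hM.regular p hp)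
  have hid : ‖ContinuousLinearMap.id ℝ (Cn n)‖ < 2 :=
    lt_of_le_of_lt ContinuousLinearMap.norm_id_le (by norm_num)
  have hV : ∀ᶠ y in 𝓝 p, Θ y ∈ V := by
    apply h1.hasFDerivAt.continuousAt
    rw [h2]
    exact hM.isOpen.mem_nhds (hM.subset hp)
  have hdiff : ∀ᶠ y in 𝓝 p, DifferentiableAt ℝ Θ y := by
    have hc1 : ContDiffAt ℝ 1 Θ p := hc.of_le (by simp)
    filter_upwards [hc1.eventually (by simp)] with y hy
    exact hy.differentiableAt (by simp)
  have hbd : ∀ᶠ y in 𝓝 p, ‖fderiv ℝ Θ y‖ < 2 := by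
    have : ContinuousAt (fun y => ‖fderiv ℝ Θ y‖) p :=
      (hc.continuousAt_fderiv (by simp)).norm
    apply this.eventually_lt continuousAt_const
    rw [h1.hasFDerivAt.fderiv]
    exact hid
  obtain ⟨r, hr, hball⟩ := Metric.eventually_nhds_iff_ball.1 (hV.and (hdiff.and (hbd.and h3)))
  obtain ⟨s, hs, hlip⟩ := h1'.exists_lipschitzOnWith_of_nnnorm_lt 2 (by
    rw [← NNReal.coe_lt_coe]; exact hid)
  have hΦc : ∀ᶠ x in 𝓝 p, Φ x ∈ Metric.ball p r := by
    apply h1'.hasFDerivAt.continuousAt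
    rw [h2']
    exact Metric.ball_mem_nhds p hr
  refine ⟨s ∩ {x | Φ x ∈ Metric.ball p r ∧ Θ (Φ x) = x}, inter_mem hs (hΦc.and h4), ?_⟩
  intro g hg ε hε
  have hε0 : 0 ≤ ε := (norm_nonneg _).trans (hε p hp)
  -- `Θ` maps the convex set `D` into `M`, so the mean value inequality applies to `g ∘ Θ` on `D`
  set D : Set (Cn n) := Metric.ball p r ∩ {y | fderiv ℝ γ p (y - p) = 0} with hD
  have hconv : Convex ℝ D := by
    refine (convex_ball p r).inter ?_
    have : {y | fderiv ℝ γ p (y - p) = 0} =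
        {y | (fderiv ℝ γ p : Cn n → ℝ) y = fderiv ℝ γ p p} := by
      ext y
      simp [map_sub, sub_eq_zero]
    rw [this]
    exact convex_hyperplane (fderiv ℝ γ p).isBoundedLinearMap.toIsLinearMap _
  have hDM : ∀ y ∈ D, Θ y ∈ M := by
    rintro y ⟨hy1, hy2⟩
    obtain ⟨hy3, -, -, hy4⟩ := hball y hy1
    rw [hM.eq_zeros]
    exact ⟨hy3, hy4.trans hy2⟩
  have key : ∀ y ∈ D, ∀ y' ∈ D, ‖g (Θ y') - g (Θ y)‖ ≤ ε * 2 * ‖y' - y‖ := by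
    intro y hy y' hy'
    refine Convex.norm_image_sub_le_of_norm_hasFDerivWithin_le (f := g ∘ Θ) (𝕜 := ℝ)
      (f' := fun y => (fderiv ℝ g (Θ y)).comp (fderiv ℝ Θ y)) ?_ ?_ hconv hy hy'
    · intro x hx
      exact ((hg _ (hDM x hx)).hasFDerivAt.comp x
        (hball x hx.1).2.1.hasFDerivAt).hasFDerivWithinAt
    · intro x hx
      refine (ContinuousLinearMap.opNorm_comp_le _ _).trans ?_
      exact mul_le_mul (hε _ (hDM x hx)) (hball x hx.1).2.2.1.le (norm_nonneg _) hε0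
  rintro q ⟨hqM, hqs, hq1, hq2⟩ q' ⟨hqM', hqs', hq1', hq2'⟩
  have a1 := key (Φ q') ⟨hq1', (h5 q').trans (hM.eq_zero hqM')⟩ (Φ q)
    ⟨hq1, (h5 q).trans (hM.eq_zero hqM)⟩
  rw [hq2, hq2'] at a1
  have a2 := hlip.norm_sub_le hqs hqs'
  simp only [NNReal.coe_ofNat] at a2
  calc ‖g q - g q'‖ ≤ ε * 2 * ‖Φ q - Φ q'‖ := a1
    _ ≤ ε * 2 * (2 * ‖q - q'‖) := by gcongr
    _ = 4 * ε * ‖q - q'‖ := by ring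

/-- A function whose values and derivative are small at the points of `M` has a small Lipschitz
constant on `M`. -/
theorem exists_lipschitz : ∃ C : ℝ, 0 < C ∧ ∀ g : Cn n → F, (∀ q ∈ M, DifferentiableAt ℝ g q) →
    ∀ ε : ℝ, (∀ q ∈ M, ‖g q‖ ≤ ε) → (∀ q ∈ M, ‖fderiv ℝ g q‖ ≤ ε) →
      ∀ q ∈ M, ∀ q' ∈ M, ‖g q - g q'‖ ≤ C * ε * ‖q - q'‖ := by
  have key : ∃ r : ℝ, 0 < r ∧ ∀ q ∈ M, ∀ q' ∈ M, ‖q - q'‖ < r → ∀ g : Cn n → F,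
      (∀ q ∈ M, DifferentiableAt ℝ g q) → ∀ ε : ℝ, (∀ q ∈ M, ‖fderiv ℝ g q‖ ≤ ε) →
      ‖g q - g q'‖ ≤ 4 * ε * ‖q - q'‖ := by
    refine hM.isCompact.induction_on (p := fun S => ∃ r : ℝ, 0 < r ∧ ∀ q ∈ S, ∀ q' ∈ M,
      ‖q - q'‖ < r → ∀ g : Cn n → F, (∀ q ∈ M, DifferentiableAt ℝ g q) → ∀ ε : ℝ,
      (∀ q ∈ M, ‖fderiv ℝ g q‖ ≤ ε) → ‖g q - g q'‖ ≤ 4 * ε * ‖q - q'‖)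
      ⟨1, one_pos, by simp⟩ ?_ ?_ ?_
    · rintro s t hst ⟨r, hr, h⟩
      exact ⟨r, hr, fun q hq => h q (hst hq)⟩
    · rintro s t ⟨r, hr, h⟩ ⟨r', hr', h'⟩
      refine ⟨min r r', lt_min hr hr', ?_⟩
      rintro q (hq | hq) q' hq' hlt
      · exact h q hq q' hq' (hlt.trans_le (min_le_left _ _))
      · exact h' q hq q' hq' (hlt.trans_le (min_le_right _ _))
    · intro p hp
      obtain ⟨t, ht, h⟩ := hM.exists_local_lipschitz (F := F) hp
      obtain ⟨r, hr, hrt⟩ := Metric.mem_nhds_iff.1 ht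
      refine ⟨M ∩ Metric.ball p (r / 2), inter_mem self_mem_nhdsWithin
        (mem_nhdsWithin_of_mem_nhds (Metric.ball_mem_nhds p (half_pos hr))), r / 2, half_pos hr, ?_⟩
      rintro q ⟨hq, hqb⟩ q' hq' hlt g hg ε hε
      refine h g hg ε hε q ⟨hq, hrt ?_⟩ q' ⟨hq', hrt ?_⟩
      · exact Metric.ball_subset_ball (by linarith) hqb
      · rw [← dist_eq_norm, dist_comm] at hlt
        have := dist_triangle q' q p
        rw [Metric.mem_ball] at hqb ⊢
        linarith
  obtain ⟨r, hr, h⟩ := key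
  refine ⟨max 4 (2 / r), by positivity, ?_⟩
  intro g hg ε h0 h1 q hq q' hq'
  have hε0 : 0 ≤ ε := (norm_nonneg _).trans (h0 q hq)
  -- distant points are handled by the bound on the values of `g`
  rcases lt_or_ge ‖q - q'‖ r with hlt | hge
  · refine (h q hq q' hq' hlt g hg ε h1).trans ?_
    gcongr
    exact le_max_left _ _
  · calc ‖g q - g q'‖ ≤ ε + ε := (norm_sub_le _ _).trans (add_le_add (h0 q hq) (h0 q' hq'))
      _ = 2 / r * ε * r := by field_simp; ring
      _ ≤ max 4 (2 / r) * ε * ‖q - q'‖ := by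
        gcongr
        exact le_max_right _ _

end IsLeviHypersurface
end PseudoHermitian

namespace PseudoHermitian
open Filter Topology

/-! ### Complex linear and antilinear parts, and the Levi form -/

section Parts

variable {n : ℕ} {G : Type*} [NormedAddCommGroup G] [NormedSpace ℂ G]

/-- The complex antilinear part of a real linear map. Applied to a derivative it gives the
derivative along the `(0,1)` vector conjugate to the argument. -/
def antiPart (T : Cn n →L[ℝ] G) : Cn n →L[ℝ] G :=
  (1 / 2 : ℂ) • (T + Complex.I • T.comp (Complex.I • ContinuousLinearMap.id ℝ (Cn n)))

/-- The complex linear part of a real linear map. -/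
def linPart (T : Cn n →L[ℝ] G) : Cn n →L[ℝ] G :=
  (1 / 2 : ℂ) • (T - Complex.I • T.comp (Complex.I • ContinuousLinearMap.id ℝ (Cn n)))

theorem antiPart_apply (T : Cn n →L[ℝ] G) (v : Cn n) :
    antiPart T v = (1 / 2 : ℂ) • (T v + Complex.I • T (Complex.I • v)) := rfl

theorem linPart_apply (T : Cn n →L[ℝ] G) (v : Cn n) :
    linPart T v = (1 / 2 : ℂ) • (T v - Complex.I • T (Complex.I • v)) := rfl

theorem linPart_add_antiPart (T : Cn n →L[ℝ] G) (v : Cn n) :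
    linPart T v + antiPart T v = T v := by
  rw [antiPart_apply, linPart_apply]
  module

theorem real_smul_add_smul_I (c : ℂ) (v : G) :
    c • v = (c.re : ℝ) • v + (c.im : ℝ) • (Complex.I • v) := by
  conv_lhs => rw [← Complex.re_add_im c]
  rw [add_smul, mul_smul]
  simp

theorem map_smul_of_map_I {T : Cn n →L[ℝ] G} (h : ∀ v, T (Complex.I • v) = Complex.I • T v)
    (c : ℂ) (v : Cn n) : T (c • v) = c • T v := by
  rw [real_smul_add_smul_I c v, map_add, map_smul, map_smul, h, ← real_smul_add_smul_I]

theorem map_smul_of_map_neg_I {T : Cn n →L[ℝ] G}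
    (h : ∀ v, T (Complex.I • v) = -(Complex.I • T v)) (c : ℂ) (v : Cn n) :
    T (c • v) = (starRingEnd ℂ) c • T v := by
  rw [real_smul_add_smul_I c v, map_add, map_smul, map_smul, h,
    real_smul_add_smul_I ((starRingEnd ℂ) c)]
  simp

theorem I_smul_I_smul {G : Type*} [AddCommGroup G] [Module ℂ G] (v : G) :
    Complex.I • Complex.I • v = -v := by
  rw [smul_smul, Complex.I_mul_I, neg_one_smul]

theorem antiPart_smul (T : Cn n →L[ℝ] G) (c : ℂ) (v : Cn n) :
    antiPart T (c • v) = (starRingEnd ℂ) c • antiPart T v := by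
  refine map_smul_of_map_neg_I (fun v => ?_) c v
  simp only [antiPart_apply, I_smul_I_smul, map_neg]
  rw [smul_comm Complex.I (1 / 2 : ℂ), ← smul_neg (1 / 2 : ℂ), smul_add Complex.I, I_smul_I_smul]
  congr 1
  module

theorem linPart_smul (T : Cn n →L[ℝ] G) (c : ℂ) (v : Cn n) :
    linPart T (c • v) = c • linPart T v := by
  refine map_smul_of_map_I (fun v => ?_) c v
  simp only [linPart_apply, I_smul_I_smul, map_neg]
  rw [smul_comm Complex.I (1 / 2 : ℂ), smul_sub Complex.I, I_smul_I_smul]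
  congr 1
  module

theorem antiPart_eq_zero {T : Cn n →L[ℝ] G} {v : Cn n}
    (h : T (Complex.I • v) = Complex.I • T v) : antiPart T v = 0 := by
  rw [antiPart_apply, h, I_smul_I_smul]
  simp

theorem antiPart_eq_zero_iff {T : Cn n →L[ℝ] G} {v : Cn n} :
    antiPart T v = 0 ↔ T (Complex.I • v) = Complex.I • T v := by
  refine ⟨fun h => ?_, antiPart_eq_zero⟩
  rw [antiPart_apply, smul_eq_zero_iff_right (by norm_num)] at h
  have := congrArg (fun x => Complex.I • x) h
  simp only [smul_add, I_smul_I_smul, smul_zero] at this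
  exact (sub_eq_zero.1 (by rw [sub_eq_add_neg, add_comm] at *; simpa [add_comm] using this)).symm

end Parts

variable {n : ℕ} {M V : Set (Cn n)} {γ : Cn n → ℝ}

theorem contactForm_apply (p v : Cn n) : contactForm γ p v =
    -Complex.I * ((1 / 2) *
      ((fderiv ℝ γ p v : ℂ) - Complex.I * (fderiv ℝ γ p (Complex.I • v) : ℂ))) :=
  rfl

theorem contactForm_smul (p : Cn n) (c : ℂ) (v : Cn n) :
    contactForm γ p (c • v) = c * contactForm γ p v := by
  refine map_smul_of_map_I (T := contactForm γ p) (fun v => ?_) c v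
  simp only [contactForm_apply, I_smul_I_smul, map_neg, smul_eq_mul]
  push_cast
  linear_combination (-(Complex.I * fderiv ℝ γ p (Complex.I • v) / 2)) * Complex.I_mul_I

theorem fderiv_eq_im (p v : Cn n) : fderiv ℝ γ p v = -2 * (contactForm γ p v).im := by
  simp [contactForm_apply]

theorem mem_tangent_iff {p v : Cn n} : v ∈ tangent γ p ↔ (contactForm γ p v).im = 0 := by
  change fderiv ℝ γ p v = 0 ↔ _
  rw [fderiv_eq_im]
  simp

theorem mem_tangent_iff_conj {p v : Cn n} :
    v ∈ tangent γ p ↔ (starRingEnd ℂ) (contactForm γ p v) = contactForm γ p v := by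
  rw [mem_tangent_iff, Complex.conj_eq_iff_im]

theorem mem_contactSpace_iff {p v : Cn n} : v ∈ contactSpace γ p ↔ contactForm γ p v = 0 := by
  change v ∈ tangent γ p ∧ Complex.I • v ∈ tangent γ p ↔ _
  rw [mem_tangent_iff, mem_tangent_iff, contactForm_smul, Complex.ext_iff]
  simp [and_comm]

theorem contactForm_ne_zero {p : Cn n} (h : fderiv ℝ γ p ≠ 0) : contactForm γ p ≠ 0 := by
  intro h0
  apply h
  ext v
  rw [fderiv_eq_im, h0]
  simp

/-- The Levi form as a sesquilinear form, `L(u, v) = ∑ γ_{j k̄} u^j v̄^k`. It is read off from the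
`(0,1)` derivatives of the coefficients of `θ = -i ∂γ`. -/
def leviHerm (γ : Cn n → ℝ) (p : Cn n) : Cn n →L[ℝ] Cn n →L[ℝ] ℂ :=
  (Complex.I • antiPart (fderiv ℝ (contactForm γ) p)).flip

/-- The complex bilinear form `∑ γ_{j k} u^j v^k`. -/
def pureHess (γ : Cn n → ℝ) (p : Cn n) : Cn n →L[ℝ] Cn n →L[ℝ] ℂ :=
  Complex.I • linPart (fderiv ℝ (contactForm γ) p)

theorem leviHerm_apply (p u v : Cn n) :
    leviHerm γ p u v = Complex.I * antiPart (fderiv ℝ (contactForm γ) p) v u := rfl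

theorem pureHess_apply (p u v : Cn n) :
    pureHess γ p u v = Complex.I * linPart (fderiv ℝ (contactForm γ) p) u v := rfl

theorem fderiv_contactForm_eq (p u v : Cn n) : fderiv ℝ (contactForm γ) p v u =
    -Complex.I * (pureHess γ p v u + leviHerm γ p u v) := by
  rw [leviHerm_apply, pureHess_apply, ← mul_add, ← add_apply,
    linPart_add_antiPart, ← mul_assoc, neg_mul, Complex.I_mul_I]
  simp

theorem leviHerm_smul_right (p : Cn n) (c : ℂ) (u v : Cn n) :
    leviHerm γ p u (c • v) = (starRingEnd ℂ) c * leviHerm γ p u v := by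
  rw [leviHerm_apply, antiPart_smul, leviHerm_apply]
  simp only [smul_apply, smul_eq_mul]
  ring

theorem pureHess_smul_left (p : Cn n) (c : ℂ) (u v : Cn n) :
    pureHess γ p (c • u) v = c * pureHess γ p u v := by
  rw [pureHess_apply, linPart_smul, pureHess_apply]
  simp only [smul_apply, smul_eq_mul]
  ring

namespace IsLeviHypersurface

variable (hM : IsLeviHypersurface M V γ)
include hM

theorem contDiffOn_contactForm : ContDiffOn ℝ ∞ (contactForm γ) V := by
  have h : ContDiffOn ℝ ∞ (fderiv ℝ γ) V := hM.smooth.fderiv_of_isOpen hM.isOpen (by simp)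
  have hr : ∀ v, ContDiffOn ℝ ∞ (fun p => ((fderiv ℝ γ p v : ℝ) : ℂ)) V := fun v =>
    Complex.ofRealCLM.contDiff.comp_contDiffOn (h.clm_apply contDiffOn_const)
  rw [contDiffOn_clm_apply]
  intro v
  simp only [contactForm_apply]
  exact contDiffOn_const.mul (contDiffOn_const.mul ((hr v).sub (contDiffOn_const.mul (hr _))))

theorem contDiffAt_contactForm {p : Cn n} (hp : p ∈ V) : ContDiffAt ℝ ∞ (contactForm γ) p :=
  hM.contDiffOn_contactForm.contDiffAt (hM.isOpen.mem_nhds hp)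

theorem differentiableAt_contactForm {p : Cn n} (hp : p ∈ V) :
    DifferentiableAt ℝ (contactForm γ) p :=
  (hM.contDiffAt_contactForm hp).differentiableAt (by simp)

theorem fderiv_contactForm_apply {p : Cn n} (hp : p ∈ V) (v u : Cn n) :
    fderiv ℝ (contactForm γ) p v u = -Complex.I * ((1 / 2) * ((fderiv ℝ (fderiv ℝ γ) p v u : ℂ)
      - Complex.I * (fderiv ℝ (fderiv ℝ γ) p v (Complex.I • u) : ℂ))) := by
  have hd : HasFDerivAt (fderiv ℝ γ) (fderiv ℝ (fderiv ℝ γ) p) p :=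
    (((hM.contDiffAt hp).fderiv_right (m := ∞) (by simp)).differentiableAt
      (by simp)).hasFDerivAt
  have h1 : ∀ u : Cn n, HasFDerivAt (fun q => ((fderiv ℝ γ q u : ℝ) : ℂ))
      (Complex.ofRealCLM.comp ((fderiv ℝ (fderiv ℝ γ) p).flip u)) p := fun u => by
    refine Complex.ofRealCLM.hasFDerivAt.comp p ?_
    simpa using! hd.clm_apply (hasFDerivAt_const u p)
  have h2 : HasFDerivAt (fun q => contactForm γ q u)
      ((fderiv ℝ (contactForm γ) p).flip u) p := by
    simpa using! (hM.differentiableAt_contactForm hp).hasFDerivAt.clm_apply (hasFDerivAt_const u p)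
  have h3 := (((h1 u).sub ((h1 (Complex.I • u)).const_mul Complex.I)).const_mul
    (1 / 2 : ℂ)).const_mul (-Complex.I)
  have := congrArg (fun T : Cn n →L[ℝ] ℂ => T v) (h2.unique h3)
  simpa using! this

theorem hess_symm {p : Cn n} (hp : p ∈ V) (u v : Cn n) :
    fderiv ℝ (fderiv ℝ γ) p u v = fderiv ℝ (fderiv ℝ γ) p v u :=
  (hM.contDiffAt hp).isSymmSndFDerivAt (by simpa using! ENat.LEInfty.out) u v

theorem leviHerm_eq {p : Cn n} (hp : p ∈ V) (u v : Cn n) : leviHerm γ p u v =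
    (1 / 4) * ((fderiv ℝ (fderiv ℝ γ) p u v : ℂ)
      + fderiv ℝ (fderiv ℝ γ) p (Complex.I • u) (Complex.I • v)
      + Complex.I * (fderiv ℝ (fderiv ℝ γ) p u (Complex.I • v)
      - fderiv ℝ (fderiv ℝ γ) p (Complex.I • u) v)) := by
  rw [leviHerm_apply, antiPart_apply]
  simp only [smul_apply, add_apply,
    hM.fderiv_contactForm_apply hp, smul_eq_mul]
  rw [hM.hess_symm hp v u, hM.hess_symm hp v, hM.hess_symm hp (Complex.I • v) u,
    hM.hess_symm hp (Complex.I • v)]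
  ring_nf
  simp only [Complex.I_sq, Complex.I_pow_three, Complex.I_pow_four]
  ring

theorem leviHerm_conj {p : Cn n} (hp : p ∈ V) (u v : Cn n) :
    (starRingEnd ℂ) (leviHerm γ p u v) = leviHerm γ p v u := by
  rw [hM.leviHerm_eq hp, hM.leviHerm_eq hp]
  simp only [map_mul, map_add, map_sub, Complex.conj_ofReal, Complex.conj_I, map_div₀, map_one,
    map_ofNat]
  rw [hM.hess_symm hp v u, hM.hess_symm hp (Complex.I • v) (Complex.I • u),
    hM.hess_symm hp v, hM.hess_symm hp (Complex.I • v) u]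
  ring

theorem leviHerm_self {p : Cn n} (hp : p ∈ V) (v : Cn n) :
    leviHerm γ p v v = (leviForm γ p v : ℂ) := by
  rw [hM.leviHerm_eq hp, hM.hess_symm hp (Complex.I • v) v, leviForm]
  push_cast
  ring

theorem leviHerm_smul_left {p : Cn n} (hp : p ∈ V) (c : ℂ) (u v : Cn n) :
    leviHerm γ p (c • u) v = c * leviHerm γ p u v := by
  rw [← hM.leviHerm_conj hp, leviHerm_smul_right, map_mul, hM.leviHerm_conj hp, Complex.conj_conj]

theorem pureHess_symm {p : Cn n} (hp : p ∈ V) (u v : Cn n) :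
    pureHess γ p u v = pureHess γ p v u := by
  simp only [pureHess_apply, linPart_apply, smul_apply,
    sub_apply, hM.fderiv_contactForm_apply hp, smul_eq_mul]
  rw [hM.hess_symm hp u v, hM.hess_symm hp u, hM.hess_symm hp (Complex.I • u) v,
    hM.hess_symm hp (Complex.I • u)]
  ring_nf

theorem eq_zero_of_leviHerm_self {p : Cn n} (hp : p ∈ M) {v : Cn n} (h1 : contactForm γ p v = 0)
    (h2 : leviHerm γ p v v = 0) : v = 0 := by
  by_contra hv
  have := hM.levi_pos p hp v (mem_contactSpace_iff.2 h1) hv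
  rw [hM.leviHerm_self (hM.subset hp)] at h2
  norm_cast at h2
  exact this.ne' h2

theorem dForm_contactForm (p u v : Cn n) (hp : p ∈ V) : dForm (contactForm γ) p u v =
    Complex.I * (leviHerm γ p u v - leviHerm γ p v u) := by
  rw [dForm, fderiv_contactForm_eq, fderiv_contactForm_eq, hM.pureHess_symm hp]
  ring

/-! ### Third derivatives of the defining function -/

theorem contDiffOn_leviHerm : ContDiffOn ℝ ∞ (leviHerm γ) V := by
  have h : ContDiffOn ℝ ∞ (fderiv ℝ (contactForm γ)) V :=
    hM.contDiffOn_contactForm.fderiv_of_isOpen hM.isOpen (by simp)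
  rw [contDiffOn_clm_apply]
  intro u
  rw [contDiffOn_clm_apply]
  intro v
  have h' : ∀ w, ContDiffOn ℝ ∞ (fun q => fderiv ℝ (contactForm γ) q w u) V := fun w =>
    (h.clm_apply contDiffOn_const).clm_apply contDiffOn_const
  exact contDiffOn_const.mul (contDiffOn_const.mul ((h' v).add (contDiffOn_const.mul (h' _))))

theorem differentiableAt_leviHerm {p : Cn n} (hp : p ∈ V) :
    DifferentiableAt ℝ (leviHerm γ) p :=
  (hM.contDiffOn_leviHerm.contDiffAt (hM.isOpen.mem_nhds hp)).differentiableAt (by simp)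

theorem fderiv_leviHerm_apply {p : Cn n} (hp : p ∈ V) (v u w : Cn n) :
    fderiv ℝ (leviHerm γ) p v u w = Complex.I * ((1 / 2) *
      (fderiv ℝ (fderiv ℝ (contactForm γ)) p v w u
        + Complex.I * fderiv ℝ (fderiv ℝ (contactForm γ)) p v (Complex.I • w) u)) := by
  have hd : HasFDerivAt (fderiv ℝ (contactForm γ)) (fderiv ℝ (fderiv ℝ (contactForm γ)) p) p :=
    (((hM.contDiffAt_contactForm hp).fderiv_right (m := ∞) (by simp)).differentiableAt
      (by simp)).hasFDerivAt
  have h1 : ∀ w : Cn n, HasFDerivAt (fun q => fderiv ℝ (contactForm γ) q w u)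
      (((fderiv ℝ (fderiv ℝ (contactForm γ)) p).flip w).flip u) p := fun w => by
    have := (hd.clm_apply (hasFDerivAt_const w p)).clm_apply (hasFDerivAt_const u p)
    simpa using! this
  have h2 : HasFDerivAt (fun q => leviHerm γ q u w)
      (((fderiv ℝ (leviHerm γ) p).flip u).flip w) p := by
    have := ((hM.differentiableAt_leviHerm hp).hasFDerivAt.clm_apply
      (hasFDerivAt_const u p)).clm_apply (hasFDerivAt_const w p)
    simpa using! this
  have h3 := (((h1 w).add ((h1 (Complex.I • w)).const_mul Complex.I)).const_mul
    (1 / 2 : ℂ)).const_mul Complex.I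
  have := congrArg (fun T : Cn n →L[ℝ] ℂ => T v) (h2.unique h3)
  simpa [mul_add] using! this

theorem fderiv_leviHerm_conj {p : Cn n} (hp : p ∈ V) (v u w : Cn n) :
    (starRingEnd ℂ) (fderiv ℝ (leviHerm γ) p v u w) = fderiv ℝ (leviHerm γ) p v w u := by
  have h2 : ∀ u w, HasFDerivAt (fun q => leviHerm γ q u w)
      (((fderiv ℝ (leviHerm γ) p).flip u).flip w) p := fun u w => by
    have := ((hM.differentiableAt_leviHerm hp).hasFDerivAt.clm_apply
      (hasFDerivAt_const u p)).clm_apply (hasFDerivAt_const w p)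
    simpa using! this
  have h3 := (Complex.conjCLE : ℂ →L[ℝ] ℂ).hasFDerivAt.comp p (h2 u w)
  have h4 : (fun q => leviHerm γ q w u) =ᶠ[𝓝 p]
      ((Complex.conjCLE : ℂ →L[ℝ] ℂ) ∘ fun q => leviHerm γ q u w) := by
    filter_upwards [hM.isOpen.mem_nhds hp] with q hq
    exact (hM.leviHerm_conj hq u w).symm
  have := congrArg (fun T : Cn n →L[ℝ] ℂ => T v) ((h3.congr_of_eventuallyEq h4).unique (h2 w u))
  simpa using! this

/-- The `(0,1)` derivative of the Levi form, `∑ γ_{j k̄ l̄} u^j w̄^k v̄^l`, is symmetric in `v`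
and `w`. -/
theorem antiPart_leviHerm_symm {p : Cn n} (hp : p ∈ V) (v u w : Cn n) :
    antiPart (fderiv ℝ (leviHerm γ) p) v u w = antiPart (fderiv ℝ (leviHerm γ) p) w u v := by
  have hs : ∀ v w : Cn n, fderiv ℝ (fderiv ℝ (contactForm γ)) p v w u =
      fderiv ℝ (fderiv ℝ (contactForm γ)) p w v u := fun v w => by
    rw [(hM.contDiffAt_contactForm hp).isSymmSndFDerivAt (by simpa using! ENat.LEInfty.out) v w]
  simp only [antiPart_apply, smul_apply, add_apply,
    smul_eq_mul, hM.fderiv_leviHerm_apply hp]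
  rw [hs w v, hs (Complex.I • w) v, hs w, hs (Complex.I • w)]
  ring

theorem antiPart_leviHerm_conj {p : Cn n} (hp : p ∈ V) (v u w : Cn n) :
    (starRingEnd ℂ) (antiPart (fderiv ℝ (leviHerm γ) p) v u w) =
      linPart (fderiv ℝ (leviHerm γ) p) v w u := by
  simp only [antiPart_apply, linPart_apply, smul_apply,
    add_apply, sub_apply, smul_eq_mul, map_mul, map_add,
    hM.fderiv_leviHerm_conj hp, Complex.conj_I, map_div₀, map_one, map_ofNat]
  ring

theorem linPart_leviHerm_symm {p : Cn n} (hp : p ∈ V) (v u w : Cn n) :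
    linPart (fderiv ℝ (leviHerm γ) p) v u w = linPart (fderiv ℝ (leviHerm γ) p) u v w := by
  rw [← hM.antiPart_leviHerm_conj hp, hM.antiPart_leviHerm_symm hp, hM.antiPart_leviHerm_conj hp]

/-- The product rule for the Levi form of two vector fields. -/
theorem hasFDerivAt_leviHerm_apply {p : Cn n} (hp : p ∈ V) {X W : Cn n → Cn n}
    (hX : DifferentiableAt ℝ X p) (hW : DifferentiableAt ℝ W p) :
    DifferentiableAt ℝ (fun q => leviHerm γ q (X q) (W q)) p ∧
    ∀ v, fderiv ℝ (fun q => leviHerm γ q (X q) (W q)) p v = fderiv ℝ (leviHerm γ) p v (X p) (W p)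
      + leviHerm γ p (fderiv ℝ X p v) (W p) + leviHerm γ p (X p) (fderiv ℝ W p v) := by
  have := ((hM.differentiableAt_leviHerm hp).hasFDerivAt.clm_apply hX.hasFDerivAt).clm_apply
    hW.hasFDerivAt
  refine ⟨this.differentiableAt, fun v => ?_⟩
  rw [this.fderiv]
  simp
  ring

end IsLeviHypersurface
end PseudoHermitian

namespace PseudoHermitian
open Filter Topology

/-! ### Adapted frames -/

section Dual

variable {n : ℕ}

/-- A dual system of `n + 1` complex covectors and vectors in `ℂ^{n+1}` is complete. -/
theorem eq_sum_of_dual {a : Cn n →L[ℝ] ℂ} {b : Fin n → Cn n →L[ℝ] ℂ} {r : Cn n} {z : Fin n → Cn n}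
    (ha : ∀ v, a (Complex.I • v) = Complex.I * a v)
    (hb : ∀ α v, b α (Complex.I • v) = Complex.I * b α v)
    (har : a r = 1) (hbr : ∀ α, b α r = 0) (haz : ∀ α, a (z α) = 0)
    (hbz : ∀ α β, b α (z β) = if α = β then 1 else 0) (v : Cn n) :
    v = a v • r + ∑ α, b α v • z α := by
  let Φ : Cn n →ₗ[ℂ] ℂ × (Fin n → ℂ) :=
    { toFun := fun v => (a v, fun α => b α v)
      map_add' := fun u v => by ext <;> simp
      map_smul' := fun c v => by
        ext
        · simpa using map_smul_of_map_I (T := a) ha c v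
        · simpa using map_smul_of_map_I (T := b _) (hb _) c v }
  have hΦ : ∀ v, Φ v = (a v, fun α => b α v) := fun _ => rfl
  have hΨ : ∀ (c : ℂ) (d : Fin n → ℂ), Φ (c • r + ∑ α, d α • z α) = (c, d) := by
    intro c d
    have hz : ∀ α, Φ (d α • z α) = d α • Φ (z α) := fun α => map_smul _ _ _
    rw [map_add, map_smul, map_sum]
    simp only [hz]
    simp only [hΦ, har, hbr, haz, hbz]
    ext
    · simp [Prod.fst_sum]
    · simp [Prod.snd_sum, Finset.sum_apply]
  have hsurj : Function.Surjective Φ := fun ⟨c, d⟩ => ⟨_, hΨ c d⟩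
  have hinj : Function.Injective Φ := by
    rw [LinearMap.injective_iff_surjective_of_finrank_eq_finrank]
    · exact hsurj
    · simp [add_comm]
  apply hinj
  rw [hΨ, hΦ]

theorem exists_equiv_of_injective {T : Cn n →L[ℝ] ℂ × (Fin n → ℂ)} (hT : ∀ v, T v = 0 → v = 0) :
    ∃ e : Cn n ≃L[ℝ] ℂ × (Fin n → ℂ), (e : Cn n →L[ℝ] ℂ × (Fin n → ℂ)) = T := by
  have hinj : Function.Injective (T : Cn n →ₗ[ℝ] ℂ × (Fin n → ℂ)) :=
    LinearMap.ker_eq_bot.1 (LinearMap.ker_eq_bot'.2 hT)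
  have hfin : Module.finrank ℝ (Cn n) = Module.finrank ℝ (ℂ × (Fin n → ℂ)) := by
    rw [← Module.finrank_mul_finrank ℝ ℂ (Cn n),
      ← Module.finrank_mul_finrank ℝ ℂ (ℂ × (Fin n → ℂ))]
    simp [add_comm]
  exact ⟨(LinearEquiv.ofInjectiveOfFinrankEq _ hinj hfin).toContinuousLinearEquiv, by ext v <;> rfl⟩

/-- The dual frame of a smooth coframe is smooth. -/
theorem contDiffOn_of_dual {W : Set (Cn n)} {a : Cn n → Cn n →L[ℝ] ℂ}
    {b : Fin n → Cn n → Cn n →L[ℝ] ℂ} {r : Cn n → Cn n} {z : Fin n → Cn n → Cn n}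
    (hsa : ContDiffOn ℝ ∞ a W) (hsb : ∀ α, ContDiffOn ℝ ∞ (b α) W)
    (ha : ∀ p ∈ W, ∀ v, a p (Complex.I • v) = Complex.I * a p v)
    (hb : ∀ α, ∀ p ∈ W, ∀ v, b α p (Complex.I • v) = Complex.I * b α p v)
    (har : ∀ p ∈ W, a p (r p) = 1) (hbr : ∀ α, ∀ p ∈ W, b α p (r p) = 0)
    (haz : ∀ α, ∀ p ∈ W, a p (z α p) = 0)
    (hbz : ∀ α β, ∀ p ∈ W, b α p (z β p) = if α = β then 1 else 0) :
    ContDiffOn ℝ ∞ r W ∧ ∀ α, ContDiffOn ℝ ∞ (z α) W := by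
  let Φ : Cn n → (Cn n →L[ℝ] ℂ × (Fin n → ℂ)) := fun q =>
    (a q).prod (ContinuousLinearMap.pi fun α => b α q)
  have hΦ : ∀ q v, Φ q v = (a q v, fun α => b α q v) := fun _ _ => rfl
  have hsΦ : ContDiffOn ℝ ∞ Φ W := by
    rw [contDiffOn_clm_apply]
    intro v
    refine (hsa.clm_apply contDiffOn_const).prodMk (contDiffOn_pi.2 fun α => ?_)
    exact (hsb α).clm_apply contDiffOn_const
  have hdec : ∀ q ∈ W, ∀ v, v = a q v • r q + ∑ α, b α q v • z α q := fun q hq =>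
    eq_sum_of_dual (ha q hq) (fun α => hb α q hq) (har q hq) (fun α => hbr α q hq)
      (fun α => haz α q hq) (fun α β => hbz α β q hq)
  have hequiv : ∀ q ∈ W, ∃ e : Cn n ≃L[ℝ] ℂ × (Fin n → ℂ),
      (e : Cn n →L[ℝ] ℂ × (Fin n → ℂ)) = Φ q := by
    intro q hq
    have hinj : ∀ v, Φ q v = 0 → v = 0 := by
      intro v hv
      have hv' : (a q v, fun α => b α q v) = (0 : ℂ × (Fin n → ℂ)) := hv
      rw [Prod.mk_eq_zero] at hv'
      rw [hdec q hq v, hv'.1]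
      simp [fun α => congrFun hv'.2 α]
    exact exists_equiv_of_injective hinj
  have hinv : ContDiffOn ℝ ∞ (fun q => (Φ q).inverse) W := by
    intro q hq
    obtain ⟨e, he⟩ := hequiv q hq
    have h := contDiffAt_map_inverse (n := ∞) e
    rw [he] at h
    exact h.comp_contDiffWithinAt q (hsΦ q hq)
  have hval : ∀ q ∈ W, ∀ v, (Φ q).inverse (Φ q v) = v := by
    intro q hq v
    obtain ⟨e, he⟩ := hequiv q hq
    rw [← he]
    simp
  refine ⟨(hinv.clm_apply (contDiffOn_const (c := ((1 : ℂ), (0 : Fin n → ℂ))))).congr ?_, fun β =>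
    (hinv.clm_apply (contDiffOn_const
      (c := ((0 : ℂ), (fun α => if α = β then (1 : ℂ) else 0))))).congr ?_⟩
  · intro q hq
    rw [← hval q hq (r q), hΦ, har q hq]
    simp only [hbr _ q hq]
    rfl
  · intro q hq
    rw [← hval q hq (z β q), hΦ, haz β q hq]
    simp only [hbz _ β q hq]

/-- A smooth coframe has a smooth dual frame near each point where it is independent. -/
theorem exists_dual_frame {W₁ : Set (Cn n)} {a : Cn n → Cn n →L[ℝ] ℂ}
    {b : Fin n → Cn n → Cn n →L[ℝ] ℂ} (hW₁ : IsOpen W₁)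
    (hsa : ContDiffOn ℝ ∞ a W₁) (hsb : ∀ α, ContDiffOn ℝ ∞ (b α) W₁)
    (ha : ∀ p ∈ W₁, ∀ v, a p (Complex.I • v) = Complex.I * a p v)
    (hb : ∀ α, ∀ p ∈ W₁, ∀ v, b α p (Complex.I • v) = Complex.I * b α p v)
    {p : Cn n} (hp : p ∈ W₁) (hi : ∀ v, a p v = 0 → (∀ α, b α p v = 0) → v = 0) :
    ∃ (W : Set (Cn n)) (r : Cn n → Cn n) (z : Fin n → Cn n → Cn n), IsOpen W ∧ W ⊆ W₁ ∧ p ∈ W ∧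
      ContDiffOn ℝ ∞ r W ∧ (∀ α, ContDiffOn ℝ ∞ (z α) W) ∧
      (∀ q ∈ W, a q (r q) = 1) ∧ (∀ α, ∀ q ∈ W, b α q (r q) = 0) ∧
      (∀ α, ∀ q ∈ W, a q (z α q) = 0) ∧
      ∀ α β, ∀ q ∈ W, b α q (z β q) = if α = β then 1 else 0 := by
  let Φ : Cn n → (Cn n →L[ℝ] ℂ × (Fin n → ℂ)) := fun q =>
    (a q).prod (ContinuousLinearMap.pi fun α => b α q)
  have hΦ : ∀ q v, Φ q v = (a q v, fun α => b α q v) := fun _ _ => rfl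
  have hsΦ : ContDiffOn ℝ ∞ Φ W₁ := by
    rw [contDiffOn_clm_apply]
    intro v
    refine (hsa.clm_apply contDiffOn_const).prodMk (contDiffOn_pi.2 fun α => ?_)
    exact (hsb α).clm_apply contDiffOn_const
  let W : Set (Cn n) := W₁ ∩ Φ ⁻¹' Set.range ((↑) : (Cn n ≃L[ℝ] ℂ × (Fin n → ℂ)) → _)
  have hWo : IsOpen W :=
    hsΦ.continuousOn.isOpen_inter_preimage hW₁ ContinuousLinearEquiv.isOpen
  have hWW : W ⊆ W₁ := Set.inter_subset_left
  have hpW : p ∈ W := by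
    refine ⟨hp, exists_equiv_of_injective fun v hv => ?_⟩
    rw [hΦ, Prod.mk_eq_zero] at hv
    exact hi v hv.1 (congrFun hv.2)
  have hinv : ∀ q ∈ W, ∀ c d, a q ((Φ q).inverse (c, d)) = c ∧
      ∀ α, b α q ((Φ q).inverse (c, d)) = d α := by
    rintro q ⟨-, e, he⟩ c d
    have h : Φ q ((Φ q).inverse (c, d)) = (c, d) := by
      rw [← he]
      simp
    rw [hΦ, Prod.mk_inj] at h
    exact ⟨h.1, congrFun h.2⟩
  have hr1 : ∀ q ∈ W, a q ((Φ q).inverse (1, 0)) = 1 := fun q hq => (hinv q hq 1 0).1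
  have hr2 : ∀ α, ∀ q ∈ W, b α q ((Φ q).inverse (1, 0)) = 0 := fun α q hq => (hinv q hq 1 0).2 α
  have hz1 : ∀ β : Fin n, ∀ q ∈ W,
      a q ((Φ q).inverse (0, fun α => if α = β then 1 else 0)) = 0 := fun β q hq => (hinv q hq _ _).1
  have hz2 : ∀ α β : Fin n, ∀ q ∈ W,
      b α q ((Φ q).inverse (0, fun α => if α = β then 1 else 0)) = if α = β then 1 else 0 :=
    fun α β q hq => (hinv q hq _ _).2 α
  obtain ⟨hsr, hsz⟩ := contDiffOn_of_dual (hsa.mono hWW) (fun α => (hsb α).mono hWW)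
    (fun q hq => ha q (hWW hq)) (fun α q hq => hb α q (hWW hq)) hr1 hr2 hz1 hz2
  exact ⟨W, _, _, hWo, hWW, hpW, hsr, hsz, hr1, hr2, hz1, hz2⟩

end Dual

variable {n : ℕ} {M V : Set (Cn n)} {γ : Cn n → ℝ}

/-- A smooth coframe `θ, θ^α` with its dual frame `R = iζ`, `Z_α` on an open set `W`, such that
`R` is orthogonal to the `Z_α` for the Levi form at the points of `M`. These are the frames in
which `dθ` has no terms `θ ∧ θ^β̄` and `θ^α ∧ θ̄`. -/
structure IsAdaptedFrame (M V : Set (Cn n)) (γ : Cn n → ℝ) (W : Set (Cn n))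
    (θ : Fin n → Cn n → (Cn n →L[ℝ] ℂ)) (R : Cn n → Cn n) (Z : Fin n → Cn n → Cn n) : Prop where
  isOpen : IsOpen W
  subset : W ⊆ V
  smooth_θ : ∀ α, ContDiffOn ℝ ∞ (θ α) W
  smooth_R : ContDiffOn ℝ ∞ R W
  smooth_Z : ∀ α, ContDiffOn ℝ ∞ (Z α) W
  type10 : ∀ α, ∀ p ∈ W, ∀ v, θ α p (Complex.I • v) = Complex.I * θ α p v
  contactForm_R : ∀ p ∈ W, contactForm γ p (R p) = 1
  θ_R : ∀ α, ∀ p ∈ W, θ α p (R p) = 0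
  contactForm_Z : ∀ α, ∀ p ∈ W, contactForm γ p (Z α p) = 0
  θ_Z : ∀ α β, ∀ p ∈ W, θ α p (Z β p) = if α = β then 1 else 0
  levi_R : ∀ α, ∀ p ∈ M ∩ W, leviHerm γ p (R p) (Z α p) = 0

/-- The antilinear form `S(v) = - ∑ γ_{j k̄ l̄} r^j z̄^k v̄^l + i L(r, r) ∑ γ̄_{j k} v̄^j z̄^k`;
for an adapted frame, `S(Z_α)` with `r = R`, `z = Z_β` is the torsion `A_{ᾱβ̄}`. -/
def torsionForm (γ : Cn n → ℝ) (p r z : Cn n) : Cn n →L[ℝ] ℂ :=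
  -((antiPart (fderiv ℝ (leviHerm γ) p)).flip r).flip z
    + (Complex.I * leviHerm γ p r r) • conjForm ((pureHess γ p).flip z)

theorem torsionForm_apply (p r z v : Cn n) : torsionForm γ p r z v =
    -antiPart (fderiv ℝ (leviHerm γ) p) v r z
      + Complex.I * leviHerm γ p r r * (starRingEnd ℂ) (pureHess γ p v z) := rfl

theorem torsionForm_smul (p r z : Cn n) (c : ℂ) (v : Cn n) :
    torsionForm γ p r z (c • v) = (starRingEnd ℂ) c * torsionForm γ p r z v := by
  rw [torsionForm_apply, torsionForm_apply, antiPart_smul, pureHess_smul_left]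
  simp only [smul_apply, smul_eq_mul, map_mul]
  ring

theorem IsLeviHypersurface.torsionForm_symm (hM : IsLeviHypersurface M V γ) {p : Cn n} (hp : p ∈ V)
    (r z v : Cn n) : torsionForm γ p r z v = torsionForm γ p r v z := by
  rw [torsionForm_apply, torsionForm_apply, hM.antiPart_leviHerm_symm hp, hM.pureHess_symm hp]

namespace IsAdaptedFrame

variable {W : Set (Cn n)} {θ : Fin n → Cn n → (Cn n →L[ℝ] ℂ)} {R : Cn n → Cn n}
  {Z : Fin n → Cn n → Cn n} (hF : IsAdaptedFrame M V γ W θ R Z)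

include hF

theorem eq_sum {p : Cn n} (hp : p ∈ W) (v : Cn n) :
    v = contactForm γ p v • R p + ∑ α, θ α p v • Z α p :=
  eq_sum_of_dual (contactForm_smul p Complex.I) (fun α => hF.type10 α p hp) (hF.contactForm_R p hp)
    (fun α => hF.θ_R α p hp) (fun α => hF.contactForm_Z α p hp) (fun α β => hF.θ_Z α β p hp) v

theorem θ_smul {p : Cn n} (hp : p ∈ W) (α : Fin n) (c : ℂ) (v : Cn n) :
    θ α p (c • v) = c * θ α p v :=
  map_smul_of_map_I (T := θ α p) (hF.type10 α p hp) c v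

theorem eq_sum_of_contactForm_eq_zero {p : Cn n} (hp : p ∈ W) {v : Cn n}
    (hv : contactForm γ p v = 0) : v = ∑ α, θ α p v • Z α p := by
  conv_lhs => rw [hF.eq_sum hp v, hv, zero_smul, zero_add]

theorem differentiableAt_θ {p : Cn n} (hp : p ∈ W) (α : Fin n) : DifferentiableAt ℝ (θ α) p :=
  ((hF.smooth_θ α).contDiffAt (hF.isOpen.mem_nhds hp)).differentiableAt (by simp)

theorem differentiableAt_Z {p : Cn n} (hp : p ∈ W) (α : Fin n) : DifferentiableAt ℝ (Z α) p :=
  ((hF.smooth_Z α).contDiffAt (hF.isOpen.mem_nhds hp)).differentiableAt (by simp)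

theorem differentiableAt_R {p : Cn n} (hp : p ∈ W) : DifferentiableAt ℝ R p :=
  (hF.smooth_R.contDiffAt (hF.isOpen.mem_nhds hp)).differentiableAt (by simp)

/-- The derivatives of `θ^α` in any direction are complex linear. -/
theorem fderiv_θ_smul {p : Cn n} (hp : p ∈ W) (α : Fin n) (v : Cn n) (c : ℂ) (u : Cn n) :
    fderiv ℝ (θ α) p v (c • u) = c * fderiv ℝ (θ α) p v u := by
  have h1 : ∀ u, HasFDerivAt (fun q => θ α q u) ((fderiv ℝ (θ α) p).flip u) p := fun u => by
    simpa using! (hF.differentiableAt_θ hp α).hasFDerivAt.clm_apply (hasFDerivAt_const u p)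
  have h2 := (h1 u).const_mul c
  have h3 : (fun q => θ α q (c • u)) =ᶠ[𝓝 p] fun q => c * θ α q u := by
    filter_upwards [hF.isOpen.mem_nhds hp] with q hq
    exact hF.θ_smul hq α c u
  have := congrArg (fun T : Cn n →L[ℝ] ℂ => T v) ((h1 (c • u)).unique (h2.congr_of_eventuallyEq h3))
  simpa using! this

omit hF in
theorem fderiv_apply_of_eventually_const {a : Cn n → Cn n →L[ℝ] ℂ} {X : Cn n → Cn n} {p : Cn n}
    {c : ℂ} (ha : DifferentiableAt ℝ a p) (hX : DifferentiableAt ℝ X p)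
    (h : ∀ᶠ q in 𝓝 p, a q (X q) = c) (v : Cn n) :
    a p (fderiv ℝ X p v) = -fderiv ℝ a p v (X p) := by
  have h1 := ha.hasFDerivAt.clm_apply hX.hasFDerivAt
  have h2 := (hasFDerivAt_const (𝕜 := ℝ) c p).congr_of_eventuallyEq h
  have := congrArg (fun T : Cn n →L[ℝ] ℂ => T v) (h1.unique h2)
  exact eq_neg_of_add_eq_zero_left (by simpa using! this)

theorem θ_fderiv_Z {p : Cn n} (hp : p ∈ W) (α β : Fin n) (v : Cn n) :
    θ α p (fderiv ℝ (Z β) p v) = -fderiv ℝ (θ α) p v (Z β p) := by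
  refine fderiv_apply_of_eventually_const (hF.differentiableAt_θ hp α)
    (hF.differentiableAt_Z hp β) (c := if α = β then 1 else 0) ?_ v
  filter_upwards [hF.isOpen.mem_nhds hp] with q hq using hF.θ_Z α β q hq

theorem θ_fderiv_R {p : Cn n} (hp : p ∈ W) (α : Fin n) (v : Cn n) :
    θ α p (fderiv ℝ R p v) = -fderiv ℝ (θ α) p v (R p) := by
  refine fderiv_apply_of_eventually_const (hF.differentiableAt_θ hp α)
    (hF.differentiableAt_R hp) (c := 0) ?_ v
  filter_upwards [hF.isOpen.mem_nhds hp] with q hq using hF.θ_R α q hq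

theorem contactForm_fderiv_Z (hM : IsLeviHypersurface M V γ) {p : Cn n} (hp : p ∈ W) (β : Fin n)
    (v : Cn n) : contactForm γ p (fderiv ℝ (Z β) p v) =
      Complex.I * (pureHess γ p v (Z β p) + leviHerm γ p (Z β p) v) := by
  rw [fderiv_apply_of_eventually_const (c := 0)
    (hM.differentiableAt_contactForm (hF.subset hp)) (hF.differentiableAt_Z hp β) ?_ v,
    fderiv_contactForm_eq]
  · ring
  · filter_upwards [hF.isOpen.mem_nhds hp] with q hq using hF.contactForm_Z β q hq

theorem leviHerm_R_left {p : Cn n} (hp : p ∈ M ∩ W) (w : Cn n) :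
    leviHerm γ p (R p) w = leviHerm γ p (R p) (R p) * (starRingEnd ℂ) (contactForm γ p w) := by
  conv_lhs => rw [hF.eq_sum hp.2 w]
  rw [map_add, map_sum, leviHerm_smul_right]
  simp only [leviHerm_smul_right, hF.levi_R _ p hp, mul_zero, Finset.sum_const_zero, add_zero]
  ring

theorem leviHerm_Z_right (hM : IsLeviHypersurface M V γ) {p : Cn n} (hp : p ∈ M ∩ W) (v : Cn n)
    (μ : Fin n) : leviHerm γ p v (Z μ p) =
      ∑ β, leviHerm γ p (Z β p) (Z μ p) * θ β p v := by
  have hV := hM.subset hp.1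
  conv_lhs => rw [hF.eq_sum hp.2 v]
  rw [map_add, map_sum, add_apply, hM.leviHerm_smul_left hV, hF.levi_R _ p hp, mul_zero, zero_add,
    sum_apply]
  simp only [hM.leviHerm_smul_left hV]
  exact Finset.sum_congr rfl fun β _ => mul_comm _ _

/-- The derivative of the relation `L(R, Z_μ) = 0` along `M`. -/
theorem leviHerm_fderiv_R (hM : IsLeviHypersurface M V γ) {p : Cn n} (hp : p ∈ M ∩ W) (μ : Fin n)
    {v : Cn n} (hv : v ∈ tangent γ p) :
    leviHerm γ p (fderiv ℝ R p v) (Z μ p) + linPart (fderiv ℝ (leviHerm γ) p) v (R p) (Z μ p)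
      - Complex.I * leviHerm γ p (R p) (R p) * leviHerm γ p v (Z μ p) =
    torsionForm γ p (R p) (Z μ p) v := by
  have hV := hM.subset hp.1
  obtain ⟨h1, h2⟩ := hM.hasFDerivAt_leviHerm_apply hV (hF.differentiableAt_R hp.2)
    (hF.differentiableAt_Z hp.2 μ)
  have h3 := hM.fderiv_eq_of_eqOn hp.1 h1 (differentiableAt_const (0 : ℂ)) (by
    filter_upwards [hF.isOpen.mem_nhds hp.2] with q hq hqM
    exact hF.levi_R μ q ⟨hqM, hq⟩) hv
  rw [h2 v, hF.leviHerm_R_left hp (fderiv ℝ (Z μ) p v), hF.contactForm_fderiv_Z hM hp.2] at h3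
  have h4 : fderiv ℝ (leviHerm γ) p v (R p) (Z μ p) =
      linPart (fderiv ℝ (leviHerm γ) p) v (R p) (Z μ p)
        + antiPart (fderiv ℝ (leviHerm γ) p) v (R p) (Z μ p) := by
    rw [← linPart_add_antiPart (fderiv ℝ (leviHerm γ) p) v, add_apply, add_apply]
  simp only [map_mul, map_add, Complex.conj_I, hM.leviHerm_conj hV, h4, fderiv_fun_const,
    Pi.zero_apply, zero_apply] at h3
  rw [torsionForm_apply]
  linear_combination h3

end IsAdaptedFrame

/-- The matrix of the Levi form in vectors that are independent in the contact space is
invertible. -/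
theorem IsLeviHypersurface.isUnit_det_levi (hM : IsLeviHypersurface M V γ) {p : Cn n} (hp : p ∈ M)
    {z : Fin n → Cn n} (hz : ∀ α, contactForm γ p (z α) = 0) (hli : LinearIndependent ℂ z) :
    IsUnit (Matrix.of fun α β => leviHerm γ p (z α) (z β)).det := by
  have hV := hM.subset hp
  rw [isUnit_iff_ne_zero]
  intro h0
  obtain ⟨c, hc0, hc⟩ := Matrix.exists_vecMul_eq_zero_iff.2 h0
  apply hc0
  set x := ∑ α, c α • z α with hx
  have hθx : contactForm γ p x = 0 := by
    rw [hx, map_sum]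
    exact Finset.sum_eq_zero fun α _ => by rw [contactForm_smul, hz, mul_zero]
  have hxz : ∀ β, leviHerm γ p x (z β) = 0 := by
    intro β
    have := congrFun hc β
    simp only [Matrix.vecMul, dotProduct, Matrix.of_apply, Pi.zero_apply] at this
    rw [hx, map_sum, sum_apply, ← this]
    exact Finset.sum_congr rfl fun α _ => hM.leviHerm_smul_left hV _ _ _
  have hxx : leviHerm γ p x x = 0 := by
    conv_lhs => rw [hx]
    rw [← hx, map_sum]
    exact Finset.sum_eq_zero fun α _ => by rw [leviHerm_smul_right, hxz, mul_zero]
  have := hM.eq_zero_of_leviHerm_self hp hθx hxx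
  funext α
  exact Fintype.linearIndependent_iff.1 hli c this α

theorem IsAdaptedFrame.isUnit_det {W : Set (Cn n)} {θ : Fin n → Cn n → (Cn n →L[ℝ] ℂ)}
    {R : Cn n → Cn n} {Z : Fin n → Cn n → Cn n} (hF : IsAdaptedFrame M V γ W θ R Z)
    (hM : IsLeviHypersurface M V γ) {p : Cn n} (hp : p ∈ M ∩ W) :
    IsUnit (Matrix.of fun α β => leviHerm γ p (Z α p) (Z β p)).det := by
  refine hM.isUnit_det_levi hp.1 (z := fun α => Z α p) (fun α => hF.contactForm_Z α p hp.2) ?_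
  rw [Fintype.linearIndependent_iff]
  intro c hc α
  have := congrArg (θ α p) hc
  rw [map_sum, map_zero] at this
  simpa [hF.θ_smul hp.2, hF.θ_Z _ _ p hp.2] using this

end PseudoHermitian

namespace PseudoHermitian
open Filter Topology

/-! ### Existence of local frames -/

variable {n : ℕ} {M V : Set (Cn n)} {γ : Cn n → ℝ}

/-- Where `θ` does not vanish, its kernel has a smooth frame near each point. -/
theorem IsLeviHypersurface.exists_kernel_frame (hM : IsLeviHypersurface M V γ) {p : Cn n}
    (hp : p ∈ M) : ∃ (W : Set (Cn n)) (X : Fin n → Cn n → Cn n), IsOpen W ∧ W ⊆ V ∧ p ∈ W ∧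
      (∀ α, ContDiffOn ℝ ∞ (X α) W) ∧
      ∀ q ∈ W, ∀ w, contactForm γ q w = 0 → ∃ c : Fin n → ℂ, w = ∑ α, c α • X α q := by
  let e : Fin (n + 1) → Cn n := fun j => EuclideanSpace.single j 1
  have he : ∀ v : Cn n, v = ∑ j, v j • e j := by
    intro v
    ext i
    simp [e, Finset.sum_apply, Pi.single_apply]
  obtain ⟨j₀, hj₀⟩ : ∃ j, contactForm γ p (e j) ≠ 0 := by
    by_contra! h
    apply contactForm_ne_zero (hM.regular p hp)
    ext v
    rw [he v, map_sum]
    exact Finset.sum_eq_zero fun j _ => by rw [contactForm_smul, h, mul_zero]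
  have hg : ∀ j, ContDiffOn ℝ ∞ (fun q => contactForm γ q (e j)) V := fun j =>
    hM.contDiffOn_contactForm.clm_apply contDiffOn_const
  refine ⟨V ∩ (fun q => contactForm γ q (e j₀)) ⁻¹' {0}ᶜ, fun α q => e (j₀.succAbove α)
    - (contactForm γ q (e (j₀.succAbove α)) * (contactForm γ q (e j₀))⁻¹) • e j₀,
    (hg j₀).continuousOn.isOpen_inter_preimage hM.isOpen isOpen_compl_singleton,
    Set.inter_subset_left, ⟨hM.subset hp, hj₀⟩, fun α => ?_, fun q hq w hw =>
    ⟨fun α => w (j₀.succAbove α), ?_⟩⟩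
  · have h0 : ContDiffOn ℝ ∞ (fun q => (contactForm γ q (e j₀))⁻¹)
        (V ∩ (fun q => contactForm γ q (e j₀)) ⁻¹' {0}ᶜ) :=
      ((hg j₀).mono Set.inter_subset_left).inv fun q hq => hq.2
    exact contDiffOn_const.sub
      ((((hg _).mono Set.inter_subset_left).mul h0).smul contDiffOn_const)
  · have hq0 : contactForm γ q (e j₀) ≠ 0 := hq.2
    have h1 := he w
    rw [Fin.sum_univ_succAbove _ j₀] at h1
    rw [h1, map_add, map_sum, contactForm_smul] at hw
    simp only [contactForm_smul] at hw
    have h2 : ∑ α, (w (j₀.succAbove α) * (contactForm γ q (e (j₀.succAbove α))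
        * (contactForm γ q (e j₀))⁻¹)) = - w j₀ := by
      simp only [← mul_assoc]
      rw [← Finset.sum_mul, ← div_eq_mul_inv, div_eq_iff hq0]
      linear_combination hw
    simp only [smul_sub, smul_smul]
    rw [Finset.sum_sub_distrib, ← Finset.sum_smul, h2]
    conv_lhs => rw [h1]
    module

/-- Near each point of `M` there is an adapted frame: the forms `θ^α = L(·, X_α)` with `X_α` a frame
of `ker θ` are independent together with `θ`, and `R` in the dual frame is orthogonal to `ker θ`. -/
theorem IsLeviHypersurface.exists_isAdaptedFrame (hM : IsLeviHypersurface M V γ) {p : Cn n}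
    (hp : p ∈ M) : ∃ W θ R Z, p ∈ W ∧ IsAdaptedFrame M V γ W θ R Z := by
  obtain ⟨W₁, X, hW₁o, hW₁V, hpW₁, hsX, hspan⟩ := hM.exists_kernel_frame hp
  obtain ⟨b, hb⟩ : ∃ b : Fin n → Cn n → Cn n →L[ℝ] ℂ, ∀ α q v, b α q v = leviHerm γ q v (X α q) :=
    ⟨fun α q => (leviHerm γ q).flip (X α q), fun _ _ _ => rfl⟩
  have hker : ∀ q ∈ W₁, ∀ v w, (∀ α, b α q v = 0) → contactForm γ q w = 0 →
      leviHerm γ q v w = 0 := by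
    intro q hq v w hv hw
    obtain ⟨c, rfl⟩ := hspan q hq w hw
    rw [map_sum]
    exact Finset.sum_eq_zero fun α _ => by rw [leviHerm_smul_right, ← hb, hv, mul_zero]
  have hsb : ∀ α, ContDiffOn ℝ ∞ (b α) W₁ := fun α => by
    rw [contDiffOn_clm_apply]
    intro v
    simp only [hb]
    exact ((hM.contDiffOn_leviHerm.mono hW₁V).clm_apply contDiffOn_const).clm_apply (hsX α)
  have hb10 : ∀ α, ∀ q ∈ W₁, ∀ v, b α q (Complex.I • v) = Complex.I * b α q v :=
    fun α q hq v => by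
      rw [hb, hb, hM.leviHerm_smul_left (hW₁V hq)]
  obtain ⟨W, R, Z, hWo, hWW, hpW, hsR, hsZ, hR1, hR2, hZ1, hZ2⟩ := exists_dual_frame hW₁o
    (hM.contDiffOn_contactForm.mono hW₁V) hsb (fun q _ v => contactForm_smul q _ v) hb10 hpW₁
    fun v hv hbv => hM.eq_zero_of_leviHerm_self hp hv (hker p hpW₁ v v hbv hv)
  exact ⟨W, b, R, Z, hpW, hWo, hWW.trans hW₁V, fun α => (hsb α).mono hWW, hsR, hsZ,
    fun α q hq v => hb10 α q (hWW hq) v, hR1, hR2, hZ1, hZ2,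
    fun β q hq => hker q (hWW hq.2) _ _ (fun α => hR2 α q hq.2) (hZ1 β q hq.2)⟩

section Connection

variable {W : Set (Cn n)} {θ : Fin n → Cn n → (Cn n →L[ℝ] ℂ)} {R : Cn n → Cn n}
  {Z : Fin n → Cn n → Cn n}

/-- The matrix `h_{αβ̄} = L(Z_α, Z_β)`. -/
def frameMatrix (γ : Cn n → ℝ) (Z : Fin n → Cn n → Cn n) (p : Cn n) : Matrix (Fin n) (Fin n) ℂ :=
  Matrix.of fun α β => leviHerm γ p (Z α p) (Z β p)

/-- The connection forms `ω_β^α(v) = θ^α(D_v Z_β) + h^{αμ̄} (∂_v L)(Z_β, Z_μ) - i L(R, R) θ(v)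
δ_β^α` of an adapted frame. The first two terms are the Chern connection of the Levi form. -/
def frameConn (γ : Cn n → ℝ) (θ : Fin n → Cn n → (Cn n →L[ℝ] ℂ)) (R : Cn n → Cn n)
    (Z : Fin n → Cn n → Cn n) (β α : Fin n) (p : Cn n) : Cn n →L[ℝ] ℂ :=
  (θ α p).comp (fderiv ℝ (Z β) p)
    + ∑ μ, (frameMatrix γ Z p)⁻¹ μ α •
        ((linPart (fderiv ℝ (leviHerm γ) p)).flip (Z β p)).flip (Z μ p)
    - (Complex.I * leviHerm γ p (R p) (R p) * if β = α then 1 else 0) • contactForm γ p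

/-- The torsion `A^α_{β̄}` of an adapted frame. -/
def frameTorsion (γ : Cn n → ℝ) (R : Cn n → Cn n) (Z : Fin n → Cn n → Cn n) (α β : Fin n)
    (p : Cn n) : ℂ :=
  ∑ μ, (frameMatrix γ Z p)⁻¹ μ α * torsionForm γ p (R p) (Z μ p) (Z β p)

theorem frameConn_apply (β α : Fin n) (p v : Cn n) : frameConn γ θ R Z β α p v =
    θ α p (fderiv ℝ (Z β) p v)
      + ∑ μ, (frameMatrix γ Z p)⁻¹ μ α * linPart (fderiv ℝ (leviHerm γ) p) v (Z β p) (Z μ p)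
      - (Complex.I * leviHerm γ p (R p) (R p) * if β = α then 1 else 0) * contactForm γ p v := by
  by_cases h : β = α <;> simp [frameConn, h]

namespace IsAdaptedFrame

variable (hM : IsLeviHypersurface M V γ) (hF : IsAdaptedFrame M V γ W θ R Z)
include hM hF

/-- Raising the index of `L(v, Z_μ)` gives the components of `v`. -/
theorem sum_inv_mul_leviHerm {p : Cn n} (hp : p ∈ M ∩ W) (α : Fin n) (v : Cn n) :
    ∑ μ, (frameMatrix γ Z p)⁻¹ μ α * leviHerm γ p v (Z μ p) = θ α p v := by
  have hu : frameMatrix γ Z p * (frameMatrix γ Z p)⁻¹ = 1 :=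
    Matrix.mul_nonsing_inv _ (hF.isUnit_det hM hp)
  have h1 : ∀ μ, (frameMatrix γ Z p)⁻¹ μ α * leviHerm γ p v (Z μ p) =
      ∑ β, θ β p v * (frameMatrix γ Z p β μ * (frameMatrix γ Z p)⁻¹ μ α) := fun μ => by
    rw [hF.leviHerm_Z_right hM hp, Finset.mul_sum]
    refine Finset.sum_congr rfl fun β _ => ?_
    rw [frameMatrix, Matrix.of_apply]
    ring
  rw [Finset.sum_congr rfl fun μ _ => h1 μ, Finset.sum_comm]
  simp only [← Finset.mul_sum, ← Matrix.mul_apply, hu]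
  simp [Matrix.one_apply]

/-- Lowering an index undoes raising it. -/
theorem sum_mul_sum_inv {p : Cn n} (hp : p ∈ M ∩ W) (β : Fin n) (x : Fin n → ℂ) :
    ∑ α, leviHerm γ p (Z α p) (Z β p) * ∑ μ, (frameMatrix γ Z p)⁻¹ μ α * x μ = x β := by
  have hu : (frameMatrix γ Z p)⁻¹ * frameMatrix γ Z p = 1 :=
    Matrix.nonsing_inv_mul _ (hF.isUnit_det hM hp)
  have h1 : ∀ α, leviHerm γ p (Z α p) (Z β p) * ∑ μ, (frameMatrix γ Z p)⁻¹ μ α * x μ =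
      ∑ μ, x μ * ((frameMatrix γ Z p)⁻¹ μ α * frameMatrix γ Z p α β) := fun α => by
    rw [Finset.mul_sum]
    refine Finset.sum_congr rfl fun μ _ => ?_
    rw [show leviHerm γ p (Z α p) (Z β p) = frameMatrix γ Z p α β from rfl]
    ring
  rw [Finset.sum_congr rfl fun α _ => h1 α, Finset.sum_comm]
  simp only [← Finset.mul_sum, ← Matrix.mul_apply, hu]
  simp [Matrix.one_apply]

theorem leviHerm_eq_sum {p : Cn n} (hp : p ∈ M ∩ W) (u v : Cn n) : leviHerm γ p u v =
    (∑ α, ∑ β, leviHerm γ p (Z α p) (Z β p) * (θ α p u * (starRingEnd ℂ) (θ β p v)))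
      + leviHerm γ p (R p) (R p) * (contactForm γ p u * (starRingEnd ℂ) (contactForm γ p v)) := by
  have hV := hM.subset hp.1
  have h1 : ∀ α, leviHerm γ p (θ α p u • Z α p) v =
      ∑ β, leviHerm γ p (Z α p) (Z β p) * (θ α p u * (starRingEnd ℂ) (θ β p v)) := fun α => by
    rw [hM.leviHerm_smul_left hV, ← hM.leviHerm_conj hV, hF.leviHerm_Z_right hM hp, map_sum,
      Finset.mul_sum]
    refine Finset.sum_congr rfl fun β _ => ?_
    rw [map_mul, hM.leviHerm_conj hV]
    ring
  conv_lhs => rw [hF.eq_sum hp.2 u]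
  rw [map_add, map_sum, add_apply, sum_apply, Finset.sum_congr rfl fun α _ => h1 α,
    hM.leviHerm_smul_left hV, hF.leviHerm_R_left hp]
  ring

theorem sum_θ_mul_frameConn {p : Cn n} (hp : p ∈ M ∩ W) (α : Fin n) (u v : Cn n) :
    ∑ β, θ β p u * frameConn γ θ R Z β α p v =
      (∑ β, θ β p u * θ α p (fderiv ℝ (Z β) p v))
        + ∑ μ, (frameMatrix γ Z p)⁻¹ μ α * linPart (fderiv ℝ (leviHerm γ) p) v u (Z μ p)
        - contactForm γ p u * ∑ μ, (frameMatrix γ Z p)⁻¹ μ α *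
            linPart (fderiv ℝ (leviHerm γ) p) v (R p) (Z μ p)
        - Complex.I * leviHerm γ p (R p) (R p) * contactForm γ p v * θ α p u := by
  have hV := hM.subset hp.1
  have h1 : ∀ μ, linPart (fderiv ℝ (leviHerm γ) p) v u (Z μ p) =
      contactForm γ p u * linPart (fderiv ℝ (leviHerm γ) p) v (R p) (Z μ p) +
        ∑ β, θ β p u * linPart (fderiv ℝ (leviHerm γ) p) v (Z β p) (Z μ p) := fun μ => by
    rw [hM.linPart_leviHerm_symm hV, hM.linPart_leviHerm_symm hV v (R p)]
    conv_lhs => rw [hF.eq_sum hp.2 u]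
    rw [map_add, map_sum, linPart_smul]
    simp only [linPart_smul, add_apply, smul_apply, sum_apply, smul_eq_mul]
    congr 1
    exact Finset.sum_congr rfl fun β _ => by rw [hM.linPart_leviHerm_symm hV v]
  have h2 : ∑ μ, (frameMatrix γ Z p)⁻¹ μ α * linPart (fderiv ℝ (leviHerm γ) p) v u (Z μ p) =
      contactForm γ p u * ∑ μ, (frameMatrix γ Z p)⁻¹ μ α *
            linPart (fderiv ℝ (leviHerm γ) p) v (R p) (Z μ p)
      + ∑ β, θ β p u * ∑ μ, (frameMatrix γ Z p)⁻¹ μ α *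
            linPart (fderiv ℝ (leviHerm γ) p) v (Z β p) (Z μ p) := by
    simp only [h1, mul_add, Finset.sum_add_distrib, Finset.mul_sum]
    rw [Finset.sum_comm]
    congr 1
    · exact Finset.sum_congr rfl fun μ _ => by ring
    · exact Finset.sum_congr rfl fun μ _ => Finset.sum_congr rfl fun β _ => by ring
  simp only [frameConn_apply, mul_sub, mul_add, Finset.sum_sub_distrib, Finset.sum_add_distrib]
  rw [h2]
  simp
  ring

theorem θ_fderiv_R_add {p : Cn n} (hp : p ∈ M ∩ W) (α : Fin n) {v : Cn n} (hv : v ∈ tangent γ p) :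
    θ α p (fderiv ℝ R p v) + ∑ μ, (frameMatrix γ Z p)⁻¹ μ α *
        linPart (fderiv ℝ (leviHerm γ) p) v (R p) (Z μ p)
      - Complex.I * leviHerm γ p (R p) (R p) * θ α p v =
    ∑ μ, (frameMatrix γ Z p)⁻¹ μ α * torsionForm γ p (R p) (Z μ p) v := by
  rw [← hF.sum_inv_mul_leviHerm hM hp α (fderiv ℝ R p v), ← hF.sum_inv_mul_leviHerm hM hp α v,
    Finset.mul_sum, ← Finset.sum_add_distrib, ← Finset.sum_sub_distrib]
  refine Finset.sum_congr rfl fun μ _ => ?_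
  rw [← hF.leviHerm_fderiv_R hM hp μ hv]
  ring

omit hM in
theorem sum_inv_mul_torsionForm {p : Cn n} (hp : p ∈ M ∩ W) (α : Fin n) (v : Cn n) :
    ∑ μ, (frameMatrix γ Z p)⁻¹ μ α * torsionForm γ p (R p) (Z μ p) v =
      (starRingEnd ℂ) (contactForm γ p v) *
          ∑ μ, (frameMatrix γ Z p)⁻¹ μ α * torsionForm γ p (R p) (Z μ p) (R p)
        + ∑ β, frameTorsion γ R Z α β p * (starRingEnd ℂ) (θ β p v) := by
  have h1 : ∀ μ, torsionForm γ p (R p) (Z μ p) v =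
      (starRingEnd ℂ) (contactForm γ p v) * torsionForm γ p (R p) (Z μ p) (R p)
      + ∑ β, (starRingEnd ℂ) (θ β p v) * torsionForm γ p (R p) (Z μ p) (Z β p) := fun μ => by
    conv_lhs => rw [hF.eq_sum hp.2 v]
    rw [map_add, map_sum, torsionForm_smul]
    simp only [torsionForm_smul]
  simp only [h1, mul_add, Finset.sum_add_distrib, Finset.mul_sum, frameTorsion, Finset.sum_mul]
  congr 1
  · exact Finset.sum_congr rfl fun μ _ => by ring
  · rw [Finset.sum_comm]
    exact Finset.sum_congr rfl fun μ _ => Finset.sum_congr rfl fun β _ => by ring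

omit hM in
theorem fderiv_θ_apply {p : Cn n} (hp : p ∈ W) (α : Fin n) (u v : Cn n) :
    fderiv ℝ (θ α) p u v = -(contactForm γ p v * θ α p (fderiv ℝ R p u))
      - ∑ β, θ β p v * θ α p (fderiv ℝ (Z β) p u) := by
  conv_lhs => rw [hF.eq_sum hp v]
  rw [map_add, map_sum, hF.fderiv_θ_smul hp, hF.θ_fderiv_R hp]
  simp only [hF.fderiv_θ_smul hp, hF.θ_fderiv_Z hp, mul_neg, Finset.sum_neg_distrib]
  ring

theorem structure_eq {p : Cn n} (hp : p ∈ M ∩ W) (α : Fin n) {u v : Cn n}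
    (hu : u ∈ tangent γ p) (hv : v ∈ tangent γ p) :
    dForm (θ α) p u v =
      (∑ β, wedge (θ β p) (frameConn γ θ R Z β α p) u v)
        + ∑ β, frameTorsion γ R Z α β p * wedge (contactForm γ p) (conjForm (θ β p)) u v := by
  have hV := hM.subset hp.1
  have e1 : ∑ β, wedge (θ β p) (frameConn γ θ R Z β α p) u v =
      ∑ β, θ β p u * frameConn γ θ R Z β α p v - ∑ β, θ β p v * frameConn γ θ R Z β α p u := by
    simp [wedge]
  have e2 : ∑ β, frameTorsion γ R Z α β p * wedge (contactForm γ p) (conjForm (θ β p)) u v =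
      contactForm γ p u * ∑ β, frameTorsion γ R Z α β p * (starRingEnd ℂ) (θ β p v)
      - contactForm γ p v * ∑ β, frameTorsion γ R Z α β p * (starRingEnd ℂ) (θ β p u) := by
    rw [Finset.mul_sum, Finset.mul_sum, ← Finset.sum_sub_distrib]
    refine Finset.sum_congr rfl fun β _ => ?_
    simp only [wedge, conjForm, ContinuousLinearMap.comp_apply]
    change frameTorsion γ R Z α β p * (contactForm γ p u * (starRingEnd ℂ) (θ β p v)
      - contactForm γ p v * (starRingEnd ℂ) (θ β p u)) = _
    ring
  have e3 : ∑ μ, (frameMatrix γ Z p)⁻¹ μ α * linPart (fderiv ℝ (leviHerm γ) p) v u (Z μ p) =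
      ∑ μ, (frameMatrix γ Z p)⁻¹ μ α * linPart (fderiv ℝ (leviHerm γ) p) u v (Z μ p) :=
    Finset.sum_congr rfl fun μ _ => by rw [hM.linPart_leviHerm_symm hV]
  have e4 := hF.θ_fderiv_R_add hM hp α hu
  have e5 := hF.θ_fderiv_R_add hM hp α hv
  rw [hF.sum_inv_mul_torsionForm hp, mem_tangent_iff_conj.1 hu] at e4
  rw [hF.sum_inv_mul_torsionForm hp, mem_tangent_iff_conj.1 hv] at e5
  rw [dForm, hF.fderiv_θ_apply hp.2, hF.fderiv_θ_apply hp.2, e1, e2,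
    hF.sum_θ_mul_frameConn hM hp, hF.sum_θ_mul_frameConn hM hp, e3]
  linear_combination contactForm γ p u * e5 - contactForm γ p v * e4

theorem sum_mul_frameConn {p : Cn n} (hp : p ∈ M ∩ W) (α β : Fin n) (v : Cn n) :
    ∑ μ, leviHerm γ p (Z μ p) (Z β p) * frameConn γ θ R Z α μ p v =
      leviHerm γ p (fderiv ℝ (Z α) p v) (Z β p)
        + linPart (fderiv ℝ (leviHerm γ) p) v (Z α p) (Z β p)
        - Complex.I * leviHerm γ p (R p) (R p) * contactForm γ p v
          * leviHerm γ p (Z α p) (Z β p) := by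
  simp only [frameConn_apply, mul_sub, mul_add, Finset.sum_sub_distrib, Finset.sum_add_distrib]
  rw [hF.sum_mul_sum_inv hM hp, ← hF.leviHerm_Z_right hM hp]
  simp
  ring

theorem metric_compat {p : Cn n} (hp : p ∈ M ∩ W) (α β : Fin n) {v : Cn n}
    (hv : v ∈ tangent γ p) : tderiv M (fun q => frameMatrix γ Z q α β) p v =
      ∑ μ, (frameMatrix γ Z p μ β * frameConn γ θ R Z α μ p v
        + frameMatrix γ Z p α μ * conjForm (frameConn γ θ R Z β μ p) v) := by
  have hV := hM.subset hp.1
  obtain ⟨h1, h2⟩ := hM.hasFDerivAt_leviHerm_apply hV (hF.differentiableAt_Z hp.2 α)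
    (hF.differentiableAt_Z hp.2 β)
  rw [hM.tderiv_eq (f := fun q => frameMatrix γ Z q α β) hp.1 h1
    (Eventually.of_forall fun _ _ => rfl) hv, h2, Finset.sum_add_distrib]
  have e1 := hF.sum_mul_frameConn hM hp α β v
  have e2 := congrArg (starRingEnd ℂ) (hF.sum_mul_frameConn hM hp β α v)
  rw [map_sum] at e2
  simp only [map_mul, map_add, map_sub, hM.leviHerm_conj hV, Complex.conj_I,
    mem_tangent_iff_conj.1 hv] at e2
  have e3 : (starRingEnd ℂ) (linPart (fderiv ℝ (leviHerm γ) p) v (Z β p) (Z α p)) =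
      antiPart (fderiv ℝ (leviHerm γ) p) v (Z α p) (Z β p) := by
    rw [← hM.antiPart_leviHerm_conj hV, Complex.conj_conj]
  have e4 : fderiv ℝ (leviHerm γ) p v (Z α p) (Z β p) =
      linPart (fderiv ℝ (leviHerm γ) p) v (Z α p) (Z β p)
        + antiPart (fderiv ℝ (leviHerm γ) p) v (Z α p) (Z β p) := by
    rw [← linPart_add_antiPart (fderiv ℝ (leviHerm γ) p) v, add_apply, add_apply]
  have e5 : ∑ μ, frameMatrix γ Z p α μ * conjForm (frameConn γ θ R Z β μ p) v =
      ∑ μ, leviHerm γ p (Z α p) (Z μ p) * (starRingEnd ℂ) (frameConn γ θ R Z β μ p v) := rfl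
  have e6 : ∑ μ, frameMatrix γ Z p μ β * frameConn γ θ R Z α μ p v =
      ∑ μ, leviHerm γ p (Z μ p) (Z β p) * frameConn γ θ R Z α μ p v := rfl
  rw [e5, e6, e1, e2, e3, e4]
  ring

theorem levi {p : Cn n} (hp : p ∈ M ∩ W) : ∃ ρ : ℂ, ∀ u v,
    dForm (contactForm γ) p u v =
      (∑ α, ∑ β, Complex.I * frameMatrix γ Z p α β * wedge (θ α p) (conjForm (θ β p)) u v)
        + ρ * wedge (contactForm γ p) (conjForm (contactForm γ p)) u v := by
  refine ⟨Complex.I * leviHerm γ p (R p) (R p), fun u v => ?_⟩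
  rw [hM.dForm_contactForm _ _ _ (hM.subset hp.1), hF.leviHerm_eq_sum hM hp u v,
    hF.leviHerm_eq_sum hM hp v u]
  have e : ∑ α, ∑ β, Complex.I * frameMatrix γ Z p α β * wedge (θ α p) (conjForm (θ β p)) u v =
      Complex.I * (∑ α, ∑ β, leviHerm γ p (Z α p) (Z β p) * (θ α p u * (starRingEnd ℂ) (θ β p v)))
      - Complex.I *
        (∑ α, ∑ β, leviHerm γ p (Z α p) (Z β p) * (θ α p v * (starRingEnd ℂ) (θ β p u))) := by
    simp only [Finset.mul_sum]
    simp only [← Finset.sum_sub_distrib]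
    refine Finset.sum_congr rfl fun α _ => Finset.sum_congr rfl fun β _ => ?_
    change Complex.I * leviHerm γ p (Z α p) (Z β p) * (θ α p u * (starRingEnd ℂ) (θ β p v)
      - θ α p v * (starRingEnd ℂ) (θ β p u)) = _
    ring
  rw [e]
  change _ = _ + Complex.I * leviHerm γ p (R p) (R p) *
    (contactForm γ p u * (starRingEnd ℂ) (contactForm γ p v)
      - contactForm γ p v * (starRingEnd ℂ) (contactForm γ p u))
  ring

/-- An adapted frame, with its connection forms and torsion, is a local frame. -/
def toLocalFrame : LocalFrame M γ where
  U := W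
  isOpen := hF.isOpen
  θ := θ
  smooth := hF.smooth_θ
  type10 := hF.type10
  ζ p := -Complex.I • R p
  Z := Z
  contactForm_ζ p hp := by simp [smul_smul, hF.contactForm_R p hp]
  θ_ζ α p hp := by simp [smul_smul, hF.θ_R α p hp]
  contactForm_Z := hF.contactForm_Z
  θ_Z := hF.θ_Z
  h := frameMatrix γ Z
  conn := frameConn γ θ R Z
  A := frameTorsion γ R Z
  levi _ hp := hF.levi hM hp
  structure_eq α _ hp _ hu _ hv := hF.structure_eq hM hp α hu hv
  metric_compat α β _ hp _ hv := hF.metric_compat hM hp α β hv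

end IsAdaptedFrame

end Connection

theorem IsLeviHypersurface.exists_localFrame (hM : IsLeviHypersurface M V γ) {p : Cn n}
    (hp : p ∈ M) : ∃ E : LocalFrame M γ, p ∈ E.U := by
  obtain ⟨W, θ, R, Z, hpW, hF⟩ := hM.exists_isAdaptedFrame hp
  exact ⟨hF.toLocalFrame hM, hpW⟩

end PseudoHermitian

namespace PseudoHermitian
open Filter Topology

variable {n : ℕ} {M V : Set (Cn n)} {γ : Cn n → ℝ}

/-! ### Arbitrary local frames -/

theorem mem_tangent_of_contactForm_eq_zero {p v : Cn n} (h : contactForm γ p v = 0) :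
    v ∈ tangent γ p := by
  rw [mem_tangent_iff, h, Complex.zero_im]

theorem conj_eval10 (a : Cn n →L[ℝ] ℂ) (z : Cn n) : (starRingEnd ℂ) (eval10 a z) =
    (1 / 2) * ((starRingEnd ℂ) (a z) + Complex.I * (starRingEnd ℂ) (a (Complex.I • z))) := by
  simp only [eval10, map_mul, map_sub, map_div₀, map_one, map_ofNat, Complex.conj_I]
  ring

namespace LocalFrame

variable (hM : IsLeviHypersurface M V γ) (E : LocalFrame M γ)
include hM

/-- The Levi form in a local frame, obtained from the equation for `dθ` by polarization. -/
theorem exists_leviHerm_eq {p : Cn n} (hp : p ∈ M ∩ E.U) : ∃ ρ : ℂ, ∀ u v, leviHerm γ p u v =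
    (∑ α, ∑ β, E.h p α β * (E.θ α p u * (starRingEnd ℂ) (E.θ β p v)))
      + ρ * (contactForm γ p u * (starRingEnd ℂ) (contactForm γ p v)) := by
  have hV := hM.subset hp.1
  obtain ⟨ρ, hρ⟩ := E.levi p hp
  refine ⟨-Complex.I * ρ, fun u v => ?_⟩
  have hI : Complex.I * Complex.I = -1 := Complex.I_mul_I
  -- the combination `dθ(u, v) - i dθ(iu, v) = 2i L(u, v)` isolates the part of `dθ` linear in `u`
  have h1 := hρ u v
  have h2 := hρ (Complex.I • u) v
  rw [hM.dForm_contactForm _ _ _ hV] at h1 h2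
  rw [hM.leviHerm_smul_left hV, leviHerm_smul_right, Complex.conj_I] at h2
  have hw : ∀ (a b : Cn n →L[ℝ] ℂ) (_ : ∀ v, a (Complex.I • v) = Complex.I * a v)
      (_ : ∀ v, b (Complex.I • v) = Complex.I * b v),
      wedge a (conjForm b) (Complex.I • u) v = Complex.I * (a u * (starRingEnd ℂ) (b v)
        + a v * (starRingEnd ℂ) (b u)) := by
    intro a b ha hb
    change a (Complex.I • u) * (starRingEnd ℂ) (b v) - a v * (starRingEnd ℂ) (b (Complex.I • u)) = _
    rw [ha, hb, map_mul, Complex.conj_I]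
    ring
  have hw' : ∀ (a b : Cn n →L[ℝ] ℂ), wedge a (conjForm b) u v =
      a u * (starRingEnd ℂ) (b v) - a v * (starRingEnd ℂ) (b u) := fun _ _ => rfl
  have h10 := fun α => E.type10 α p hp.2
  have e1 : ∑ α, ∑ β, Complex.I * E.h p α β *
        wedge (E.θ α p) (conjForm (E.θ β p)) (Complex.I • u) v =
      -(∑ α, ∑ β, E.h p α β * (E.θ α p u * (starRingEnd ℂ) (E.θ β p v)))
      - (∑ α, ∑ β, E.h p α β * (E.θ α p v * (starRingEnd ℂ) (E.θ β p u))) := by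
    simp only [← Finset.sum_neg_distrib, ← Finset.sum_sub_distrib]
    refine Finset.sum_congr rfl fun α _ => Finset.sum_congr rfl fun β _ => ?_
    rw [hw _ _ (h10 α) (h10 β)]
    linear_combination (E.h p α β * (E.θ α p u * (starRingEnd ℂ) (E.θ β p v)
      + E.θ α p v * (starRingEnd ℂ) (E.θ β p u))) * hI
  have e2 : ∑ α, ∑ β, Complex.I * E.h p α β * wedge (E.θ α p) (conjForm (E.θ β p)) u v =
      Complex.I * (∑ α, ∑ β, E.h p α β * (E.θ α p u * (starRingEnd ℂ) (E.θ β p v)))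
      - Complex.I * (∑ α, ∑ β, E.h p α β * (E.θ α p v * (starRingEnd ℂ) (E.θ β p u))) := by
    simp only [Finset.mul_sum]
    simp only [← Finset.sum_sub_distrib]
    refine Finset.sum_congr rfl fun α _ => Finset.sum_congr rfl fun β _ => ?_
    rw [hw']
    ring
  rw [e1, hw _ _ (fun v => contactForm_smul p _ v) (fun v => contactForm_smul p _ v)] at h2
  rw [e2, hw'] at h1
  linear_combination (-Complex.I / 2) * h1 - (1 / 2) * h2
    + (leviHerm γ p u v
      - (1 / 2) * (∑ α, ∑ β, E.h p α β * (E.θ α p u * (starRingEnd ℂ) (E.θ β p v)))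
      + (1 / 2) * (∑ α, ∑ β, E.h p α β * (E.θ α p v * (starRingEnd ℂ) (E.θ β p u)))) * hI

theorem h_eq {p : Cn n} (hp : p ∈ M ∩ E.U) (α β : Fin n) :
    E.h p α β = leviHerm γ p (E.Z α p) (E.Z β p) := by
  obtain ⟨ρ, hρ⟩ := E.exists_leviHerm_eq hM hp
  rw [hρ]
  simp [E.θ_Z _ _ p hp.2, E.contactForm_Z _ p hp.2]

theorem h_eq_frameMatrix {p : Cn n} (hp : p ∈ M ∩ E.U) : E.h p = frameMatrix γ E.Z p := by
  ext α β
  exact E.h_eq hM hp α β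

theorem isAdaptedFrame :
    IsAdaptedFrame M V γ (E.U ∩ V) E.θ (fun p => Complex.I • E.ζ p) E.Z := by
  have hs := contDiffOn_of_dual (W := E.U ∩ V)
    (hM.contDiffOn_contactForm.mono Set.inter_subset_right)
    (fun α => (E.smooth α).mono Set.inter_subset_left)
    (fun p _ v => contactForm_smul p _ v) (fun α p hp => E.type10 α p hp.1)
    (fun p hp => E.contactForm_ζ p hp.1) (fun α p hp => E.θ_ζ α p hp.1)
    (fun α p hp => E.contactForm_Z α p hp.1) (fun α β p hp => E.θ_Z α β p hp.1)
  refine ⟨E.isOpen.inter hM.isOpen, Set.inter_subset_right,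
    fun α => (E.smooth α).mono Set.inter_subset_left, hs.1, hs.2,
    fun α p hp => E.type10 α p hp.1, fun p hp => E.contactForm_ζ p hp.1,
    fun α p hp => E.θ_ζ α p hp.1, fun α p hp => E.contactForm_Z α p hp.1,
    fun α β p hp => E.θ_Z α β p hp.1, ?_⟩
  rintro μ p ⟨hpM, hpU, -⟩
  obtain ⟨ρ, hρ⟩ := E.exists_leviHerm_eq hM ⟨hpM, hpU⟩
  rw [hρ]
  simp [E.θ_ζ _ p hpU, E.contactForm_Z _ p hpU]

/-- The `(0,1)` derivatives of `θ^α` along `Z_μ̄` are given by the connection and the torsion. -/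
theorem antiPart_fderiv_θ {p : Cn n} (hp : p ∈ M ∩ E.U) (α μ : Fin n) (w : Cn n) :
    antiPart (fderiv ℝ (E.θ α) p) (E.Z μ p) w =
      -(∑ β, E.θ β p w * antiPart (E.conn β α p) (E.Z μ p)) - contactForm γ p w * E.A α μ p := by
  have hF := E.isAdaptedFrame hM
  have hpU : p ∈ E.U ∩ V := ⟨hp.2, hM.subset hp.1⟩
  have hI : Complex.I * Complex.I = -1 := Complex.I_mul_I
  -- the structure equation for `Z_μ` and `i Z_μ` against a tangent `w`; the equation is then
  -- extended to all `w`, since `R` and the `Z_ν` are tangent and both sides are complex linear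
  have key : ∀ w ∈ tangent γ p, antiPart (fderiv ℝ (E.θ α) p) (E.Z μ p) w =
      -(∑ β, E.θ β p w * antiPart (E.conn β α p) (E.Z μ p)) - contactForm γ p w * E.A α μ p := by
    intro w hw
    have hZ := E.contactForm_Z μ p hp.2
    have hIZ : contactForm γ p (Complex.I • E.Z μ p) = 0 := by rw [contactForm_smul, hZ, mul_zero]
    have h10 := fun α v => E.type10 α p hp.2 v
    have s1 := E.structure_eq α p hp _ (mem_tangent_of_contactForm_eq_zero hZ) w hw
    have s2 := E.structure_eq α p hp _ (mem_tangent_of_contactForm_eq_zero hIZ) w hw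
    have hc : ∀ β u, conjForm (E.θ β p) u = (starRingEnd ℂ) (E.θ β p u) := fun _ _ => rfl
    simp only [dForm, wedge, hZ, hIZ, hc, h10, E.θ_Z _ _ p hp.2, hF.fderiv_θ_smul hpU,
      Finset.sum_sub_distrib, zero_mul, zero_sub] at s1 s2
    simp only [ite_mul, mul_ite, mul_one, mul_zero, one_mul, zero_mul, Finset.sum_ite_eq',
      Finset.mem_univ, if_true, map_zero, map_one, Complex.conj_I, apply_ite (starRingEnd ℂ),
      mul_neg, Finset.sum_neg_distrib] at s1 s2
    simp only [antiPart_apply, smul_apply, add_apply, smul_eq_mul]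
    have e : ∑ β, E.θ β p w * (1 / 2 * (E.conn β α p (E.Z μ p)
        + Complex.I * E.conn β α p (Complex.I • E.Z μ p))) =
        (1 / 2) * (∑ β, E.θ β p w * E.conn β α p (E.Z μ p))
        + (1 / 2) * Complex.I * ∑ β, E.θ β p w * E.conn β α p (Complex.I • E.Z μ p) := by
      rw [Finset.mul_sum, Finset.mul_sum, ← Finset.sum_add_distrib]
      exact Finset.sum_congr rfl fun β _ => by ring
    rw [e]
    linear_combination (1 / 2) * s1 + (1 / 2) * Complex.I * s2 + (1 / 2) * (E.conn μ α p w
      + E.A α μ p * contactForm γ p w + fderiv ℝ (E.θ α) p w (E.Z μ p)) * hI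
  have hR : Complex.I • E.ζ p ∈ tangent γ p := by
    rw [mem_tangent_iff, E.contactForm_ζ p hp.2, Complex.one_im]
  have hsm : ∀ (c : ℂ) u, antiPart (fderiv ℝ (E.θ α) p) (E.Z μ p) (c • u) =
      c * antiPart (fderiv ℝ (E.θ α) p) (E.Z μ p) u := by
    intro c u
    simp only [antiPart_apply, smul_apply, add_apply, smul_eq_mul, hF.fderiv_θ_smul hpU]
    ring
  have kR := key _ hR
  have kZ := fun ν => key _ (mem_tangent_of_contactForm_eq_zero (E.contactForm_Z ν p hp.2))
  simp only [E.θ_ζ _ p hp.2, E.contactForm_ζ p hp.2, zero_mul, Finset.sum_const_zero, neg_zero,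
    zero_sub, one_mul] at kR
  simp only [E.θ_Z _ _ p hp.2, E.contactForm_Z _ p hp.2, zero_mul, sub_zero, ite_mul, one_mul,
    Finset.sum_ite_eq', Finset.mem_univ, if_true] at kZ
  conv_lhs => rw [hF.eq_sum hpU w]
  rw [map_add, map_sum, hsm, kR]
  simp only [hsm, kZ]
  simp only [mul_neg, Finset.sum_neg_distrib]
  ring

/-- The torsion with lowered index, expressed by the third derivatives of the defining function. -/
theorem sum_h_mul_A {p : Cn n} (hp : p ∈ M ∩ E.U) (ν μ : Fin n) :
    ∑ α, E.h p α ν * E.A α μ p = torsionForm γ p (Complex.I • E.ζ p) (E.Z ν p) (E.Z μ p) := by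
  have hF := E.isAdaptedFrame hM
  have hV := hM.subset hp.1
  have hpU : p ∈ E.U ∩ V := ⟨hp.2, hV⟩
  set R : Cn n → Cn n := fun p => Complex.I • E.ζ p with hR
  have hA : ∀ α, E.A α μ p = E.θ α p (antiPart (fderiv ℝ R p) (E.Z μ p)) := by
    intro α
    have h1 := E.antiPart_fderiv_θ hM hp α μ (R p)
    simp only [hR, E.θ_ζ _ p hp.2, E.contactForm_ζ p hp.2, zero_mul, Finset.sum_const_zero,
      neg_zero, zero_sub, one_mul] at h1
    rw [← neg_eq_iff_eq_neg] at h1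
    rw [← h1, antiPart_apply, antiPart_apply, hF.θ_smul hpU, map_add, hF.θ_smul hpU,
      hF.θ_fderiv_R hpU, hF.θ_fderiv_R hpU]
    simp only [smul_apply, add_apply, smul_eq_mul]
    ring
  have h2 := hF.leviHerm_Z_right hM ⟨hp.1, hpU⟩ (antiPart (fderiv ℝ R p) (E.Z μ p)) ν
  simp only [hA, E.h_eq hM hp]
  rw [← h2]
  have hZ := E.contactForm_Z μ p hp.2
  have hIZ : contactForm γ p (Complex.I • E.Z μ p) = 0 := by rw [contactForm_smul, hZ, mul_zero]
  -- the terms linear in `v` drop out of the antilinear part of the derivative of `L(R, Z_ν) = 0`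
  have e1 := hF.leviHerm_fderiv_R hM ⟨hp.1, hpU⟩ ν (mem_tangent_of_contactForm_eq_zero hZ)
  have e2 := hF.leviHerm_fderiv_R hM ⟨hp.1, hpU⟩ ν (mem_tangent_of_contactForm_eq_zero hIZ)
  rw [torsionForm_smul, linPart_smul, hM.leviHerm_smul_left hV _ (E.Z μ p), Complex.conj_I] at e2
  simp only [smul_apply, smul_eq_mul] at e2
  rw [antiPart_apply, hM.leviHerm_smul_left hV, map_add, add_apply, hM.leviHerm_smul_left hV]
  have hI : Complex.I * Complex.I = -1 := Complex.I_mul_I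
  linear_combination (1 / 2) * e1 + (1 / 2) * Complex.I * e2
    + (-(1 / 2) * torsionForm γ p (R p) (E.Z ν p) (E.Z μ p)
      - (1 / 2) * linPart (fderiv ℝ (leviHerm γ) p) (E.Z μ p) (R p) (E.Z ν p)
      + (1 / 2) * Complex.I * leviHerm γ p (R p) (R p) * leviHerm γ p (E.Z μ p) (E.Z ν p)) * hI

theorem sum_h_mul_A_symm {p : Cn n} (hp : p ∈ M ∩ E.U) (ν μ : Fin n) :
    ∑ α, E.h p α ν * E.A α μ p = ∑ α, E.h p α μ * E.A α ν p := by
  rw [E.sum_h_mul_A hM hp, E.sum_h_mul_A hM hp, hM.torsionForm_symm (hM.subset hp.1)]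

end LocalFrame

/-! ### The vector field `Y_f` -/

/-- `y` is the value at `p` of the vector field `Y_f`, in terms of the conditions that
characterize it without reference to a frame: `θ(y) = f` and `L(y, w) = i ∂̄f(w̄)` for `w` in the
contact space. -/
def IsContactLift (M : Set (Cn n)) (γ : Cn n → ℝ) (f : Cn n → ℂ) (p y : Cn n) : Prop :=
  contactForm γ p y = f p ∧
    ∀ w, contactForm γ p w = 0 → leviHerm γ p y w = Complex.I * dbar M f p w

theorem dbar_eq_antiPart (f : Cn n → ℂ) (p w : Cn n) :
    dbar M f p w = antiPart (fderivWithin ℝ f M p) w := rfl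

theorem IsContactLift.eq (hM : IsLeviHypersurface M V γ) {f : Cn n → ℂ} {p y y' : Cn n} (hp : p ∈ M)
    (h : IsContactLift M γ f p y) (h' : IsContactLift M γ f p y') : y = y' := by
  have h0 : contactForm γ p (y - y') = 0 := by rw [map_sub, h.1, h'.1, sub_self]
  refine sub_eq_zero.1 (hM.eq_zero_of_leviHerm_self hp h0 ?_)
  rw [map_sub (leviHerm γ p) y y', sub_apply, h.2 _ h0, h'.2 _ h0, sub_self]

theorem LocalFrame.isContactLift_Y (hM : IsLeviHypersurface M V γ) (E : LocalFrame M γ) {p : Cn n}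
    (hp : p ∈ M ∩ E.U) (f : Cn n → ℂ) : IsContactLift M γ f p (E.Y f p) := by
  have hF := E.isAdaptedFrame hM
  have hV := hM.subset hp.1
  have hpU : p ∈ E.U ∩ V := ⟨hp.2, hV⟩
  have hY : E.Y f p = f p • Complex.I • E.ζ p + ∑ α, (Complex.I * E.grad f α p) • E.Z α p := by
    rw [LocalFrame.Y, smul_add, Finset.smul_sum, smul_comm]
    simp only [smul_smul]
  refine ⟨?_, fun w hw => ?_⟩
  · rw [hY, map_add, map_sum, contactForm_smul, E.contactForm_ζ p hp.2]
    simp [contactForm_smul, E.contactForm_Z _ p hp.2]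
  · have hZ : ∀ μ, leviHerm γ p (E.Y f p) (E.Z μ p) = Complex.I * dbar M f p (E.Z μ p) := by
      intro μ
      have h1 := hF.sum_mul_sum_inv hM ⟨hp.1, hpU⟩ μ (fun ν => E.cov1 f ν p)
      rw [← E.h_eq_frameMatrix hM hp] at h1
      rw [hY, map_add, map_sum, add_apply, sum_apply, hM.leviHerm_smul_left hV,
        hF.levi_R μ p ⟨hp.1, hpU⟩, mul_zero, zero_add]
      simp only [hM.leviHerm_smul_left hV]
      rw [show dbar M f p (E.Z μ p) = E.cov1 f μ p from rfl, ← h1, Finset.mul_sum]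
      refine Finset.sum_congr rfl fun α _ => ?_
      rw [LocalFrame.grad]
      simp only [LocalFrame.hInv]
      ring
    rw [hF.eq_sum_of_contactForm_eq_zero hpU hw, dbar_eq_antiPart, map_sum, map_sum,
      Finset.mul_sum]
    refine Finset.sum_congr rfl fun α _ => ?_
    rw [leviHerm_smul_right, hZ, antiPart_smul, dbar_eq_antiPart, smul_eq_mul]
    ring

theorem IsLeviHypersurface.isContactLift_contactField (hM : IsLeviHypersurface M V γ) (f : M → ℂ)
    (p : M) : IsContactLift M γ (ext0 M f) p (contactField M γ f p) := by
  have H : ∃ E : LocalFrame M γ, (p : Cn n) ∈ E.U := hM.exists_localFrame p.2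
  rw [contactField, dif_pos H]
  exact H.choose.isContactLift_Y hM ⟨p.2, H.choose_spec⟩ _

end PseudoHermitian

namespace PseudoHermitian
open Filter Topology

variable {n : ℕ} {M V : Set (Cn n)} {γ : Cn n → ℝ}

/-! ### The operator `𝔇_J` and the `∂̄_b` derivative of `Y_f` -/

/-- The `(0,1)` derivative of the relation `θ(Y) = f`, using `∂_w̄ θ(y) = -i L(y, w)`. -/
theorem contactForm_antiPart_fderiv (hM : IsLeviHypersurface M V γ) {p : Cn n} (hp : p ∈ M)
    {f : Cn n → ℂ} {Y : Cn n → Cn n} (hY : DifferentiableAt ℝ Y p)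
    (hf : ∀ᶠ q in 𝓝 p, q ∈ M → contactForm γ q (Y q) = f q)
    {w : Cn n} (hw : contactForm γ p w = 0) :
    dbar M f p w = -Complex.I * leviHerm γ p (Y p) w
      + contactForm γ p (antiPart (fderiv ℝ Y p) w) := by
  have hd := (hM.differentiableAt_contactForm (hM.subset hp)).hasFDerivAt.clm_apply hY.hasFDerivAt
  have hIw : contactForm γ p (Complex.I • w) = 0 := by rw [contactForm_smul, hw, mul_zero]
  have ht : ∀ v, contactForm γ p v = 0 → tderiv M f p v =
      fderiv ℝ (contactForm γ) p v (Y p) + contactForm γ p (fderiv ℝ Y p v) := by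
    intro v hv
    rw [hM.tderiv_eq hp hd.differentiableAt (hf.mono fun q h hq => (h hq).symm)
      (mem_tangent_of_contactForm_eq_zero hv), hd.fderiv]
    simp
    ring
  rw [dbar, ht _ hw, ht _ hIw, leviHerm_apply, antiPart_apply, antiPart_apply, contactForm_smul,
    map_add, contactForm_smul]
  simp only [smul_apply, add_apply, smul_eq_mul]
  linear_combination (1 / 2) * (fderiv ℝ (contactForm γ) p w (Y p)
    + Complex.I * fderiv ℝ (contactForm γ) p (Complex.I • w) (Y p)) * Complex.I_mul_I

namespace LocalFrame

variable (hM : IsLeviHypersurface M V γ) (E : LocalFrame M γ)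
include hM

theorem cov1_eq {p : Cn n} (hp : p ∈ M ∩ E.U) {f : Cn n → ℂ} {y : Cn n}
    (hy : IsContactLift M γ f p y) (α : Fin n) :
    E.cov1 f α p = -Complex.I * ∑ β, leviHerm γ p (E.Z β p) (E.Z α p) * E.θ β p y := by
  have hF := E.isAdaptedFrame hM
  rw [← hF.leviHerm_Z_right hM ⟨hp.1, hp.2, hM.subset hp.1⟩, hy.2 _ (E.contactForm_Z α p hp.2),
    ← mul_assoc, neg_mul, Complex.I_mul_I, neg_neg, one_mul]
  rfl

theorem tderiv_cov1 {p : Cn n} (hp : p ∈ M ∩ E.U) {f : Cn n → ℂ} {Y : Cn n → Cn n}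
    (hY : DifferentiableAt ℝ Y p) (hf : ∀ᶠ q in 𝓝 p, q ∈ M → IsContactLift M γ f q (Y q))
    (α : Fin n) {v : Cn n} (hv : v ∈ tangent γ p) :
    tderiv M (E.cov1 f α) p v = -Complex.I * ∑ β,
      ((∑ κ, (E.h p κ α * E.conn β κ p v + E.h p β κ * (starRingEnd ℂ) (E.conn α κ p v)))
          * E.θ β p (Y p)
        + E.h p β α * (fderiv ℝ (E.θ β) p v (Y p) + E.θ β p (fderiv ℝ Y p v))) := by
  have hF := E.isAdaptedFrame hM
  have hV := hM.subset hp.1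
  have hpU : p ∈ E.U ∩ V := ⟨hp.2, hV⟩
  have h1 := fun β => (hM.hasFDerivAt_leviHerm_apply hV (hF.differentiableAt_Z hpU β)
    (hF.differentiableAt_Z hpU α)).1
  have h2 := fun β => (hF.differentiableAt_θ hpU β).hasFDerivAt.clm_apply hY.hasFDerivAt
  have h3 := (HasFDerivAt.fun_sum fun β (_ : β ∈ Finset.univ) =>
    (h1 β).hasFDerivAt.mul (h2 β)).const_mul (-Complex.I)
  have h4 : ∀ᶠ q in 𝓝 p, q ∈ M → E.cov1 f α q =
      -Complex.I * ∑ β, leviHerm γ q (E.Z β q) (E.Z α q) * E.θ β q (Y q) := by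
    filter_upwards [hf, E.isOpen.mem_nhds hp.2] with q hq hqU hqM
    exact E.cov1_eq hM ⟨hqM, hqU⟩ (hq hqM) α
  rw [hM.tderiv_eq hp.1 h3.differentiableAt h4 hv, h3.fderiv]
  have h5 : ∀ β, fderiv ℝ (fun q => leviHerm γ q (E.Z β q) (E.Z α q)) p v =
      ∑ κ, (E.h p κ α * E.conn β κ p v + E.h p β κ * (starRingEnd ℂ) (E.conn α κ p v)) := by
    intro β
    refine Eq.trans ?_ (E.metric_compat β α p hp v hv)
    refine (hM.tderiv_eq (f := fun q => E.h q β α) hp.1 (h1 β) ?_ hv).symm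
    filter_upwards [E.isOpen.mem_nhds hp.2] with q hqU hqM
    exact E.h_eq hM ⟨hqM, hqU⟩ β α
  simp only [smul_apply, add_apply, sum_apply, smul_eq_mul, ContinuousLinearMap.comp_apply,
    ContinuousLinearMap.flip_apply, h5, E.h_eq hM hp]
  congr 1
  refine Finset.sum_congr rfl fun β _ => ?_
  ring

/-- The second covariant derivative of `f` in terms of the `∂̄_b` derivative of `Y_f`. -/
theorem cov2_eq {p : Cn n} (hp : p ∈ M ∩ E.U) {f : Cn n → ℂ} {Y : Cn n → Cn n}
    (hY : DifferentiableAt ℝ Y p) (hf : ∀ᶠ q in 𝓝 p, q ∈ M → IsContactLift M γ f q (Y q))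
    (α μ : Fin n) : E.cov2 f α μ p =
      -Complex.I * (leviHerm γ p (antiPart (fderiv ℝ Y p) (E.Z μ p)) (E.Z α p)
        - f p * ∑ β, E.h p β α * E.A β μ p) := by
  have hF := E.isAdaptedFrame hM
  have hV := hM.subset hp.1
  have hpU : p ∈ E.U ∩ V := ⟨hp.2, hV⟩
  have hfp := hf.self_of_nhds hp.1
  have hZ := E.contactForm_Z μ p hp.2
  have hIZ : contactForm γ p (Complex.I • E.Z μ p) = 0 := by rw [contactForm_smul, hZ, mul_zero]
  have d1 := E.tderiv_cov1 hM hp hY hf α (mem_tangent_of_contactForm_eq_zero hZ)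
  have d2 := E.tderiv_cov1 hM hp hY hf α (mem_tangent_of_contactForm_eq_zero hIZ)
  have h1 : dbar M (E.cov1 f α) p (E.Z μ p) = -Complex.I * ∑ β,
      ((∑ κ, (E.h p κ α * antiPart (E.conn β κ p) (E.Z μ p)
          + E.h p β κ * (starRingEnd ℂ) (eval10 (E.conn α κ p) (E.Z μ p)))) * E.θ β p (Y p)
        + E.h p β α * (antiPart (fderiv ℝ (E.θ β) p) (E.Z μ p) (Y p)
          + E.θ β p (antiPart (fderiv ℝ Y p) (E.Z μ p)))) := by
    have e : ∀ β, ∑ κ, (E.h p κ α * antiPart (E.conn β κ p) (E.Z μ p)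
          + E.h p β κ * (starRingEnd ℂ) (eval10 (E.conn α κ p) (E.Z μ p))) =
        (1 / 2) * ((∑ κ, (E.h p κ α * E.conn β κ p (E.Z μ p)
            + E.h p β κ * (starRingEnd ℂ) (E.conn α κ p (E.Z μ p))))
          + Complex.I * ∑ κ, (E.h p κ α * E.conn β κ p (Complex.I • E.Z μ p)
            + E.h p β κ * (starRingEnd ℂ) (E.conn α κ p (Complex.I • E.Z μ p)))) := by
      intro β
      rw [Finset.mul_sum, ← Finset.sum_add_distrib, Finset.mul_sum]
      refine Finset.sum_congr rfl fun κ _ => ?_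
      rw [antiPart_apply, conj_eval10, smul_eq_mul, smul_eq_mul]
      ring
    rw [dbar, d1, d2, Finset.mul_sum, Finset.mul_sum, Finset.mul_sum, Finset.mul_sum,
      ← Finset.sum_add_distrib, Finset.mul_sum]
    refine Finset.sum_congr rfl fun β _ => ?_
    rw [e]
    simp only [antiPart_apply, hF.θ_smul hpU, map_add, smul_apply, add_apply, smul_eq_mul]
    ring
  have h2 : ∑ β, (∑ κ, (E.h p κ α * antiPart (E.conn β κ p) (E.Z μ p)
          + E.h p β κ * (starRingEnd ℂ) (eval10 (E.conn α κ p) (E.Z μ p)))) * E.θ β p (Y p) =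
      (∑ β, E.h p β α * ∑ κ, E.θ κ p (Y p) * antiPart (E.conn κ β p) (E.Z μ p))
      + ∑ κ, (starRingEnd ℂ) (eval10 (E.conn α κ p) (E.Z μ p)) *
        ∑ β, E.h p β κ * E.θ β p (Y p) := by
    simp only [Finset.sum_add_distrib, add_mul, Finset.mul_sum, Finset.sum_mul]
    congr 1
    · rw [Finset.sum_comm]
      exact Finset.sum_congr rfl fun β _ => Finset.sum_congr rfl fun κ _ => by ring
    · rw [Finset.sum_comm]
      exact Finset.sum_congr rfl fun β _ => Finset.sum_congr rfl fun κ _ => by ring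
  have h3 : ∑ κ, (starRingEnd ℂ) (eval10 (E.conn α κ p) (E.Z μ p)) * E.cov1 f κ p =
      -Complex.I * ∑ κ, (starRingEnd ℂ) (eval10 (E.conn α κ p) (E.Z μ p)) *
        ∑ β, E.h p β κ * E.θ β p (Y p) := by
    rw [Finset.mul_sum]
    refine Finset.sum_congr rfl fun κ _ => ?_
    rw [E.cov1_eq hM hp hfp]
    simp only [E.h_eq hM hp]
    ring
  have h4 : ∑ β, E.h p β α * (antiPart (fderiv ℝ (E.θ β) p) (E.Z μ p) (Y p)
          + E.θ β p (antiPart (fderiv ℝ Y p) (E.Z μ p))) =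
      leviHerm γ p (antiPart (fderiv ℝ Y p) (E.Z μ p)) (E.Z α p)
        - f p * ∑ β, E.h p β α * E.A β μ p
        - ∑ β, E.h p β α * ∑ κ, E.θ κ p (Y p) * antiPart (E.conn κ β p) (E.Z μ p) := by
    rw [hF.leviHerm_Z_right hM ⟨hp.1, hpU⟩, Finset.mul_sum, ← Finset.sum_sub_distrib,
      ← Finset.sum_sub_distrib]
    refine Finset.sum_congr rfl fun β _ => ?_
    rw [E.antiPart_fderiv_θ hM hp, hfp.1, E.h_eq hM hp]
    ring
  rw [cov2, h1, h3, Finset.sum_add_distrib, h2, h4]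
  ring

/-- The tensor `𝔇_J f` is `∂̄_b Y_f`, with indices moved by the Levi form. -/
theorem DJ_eq {p : Cn n} (hp : p ∈ M ∩ E.U) {f : Cn n → ℂ} {Y : Cn n → Cn n}
    (hY : DifferentiableAt ℝ Y p) (hf : ∀ᶠ q in 𝓝 p, q ∈ M → IsContactLift M γ f q (Y q))
    (α β : Fin n) : E.DJ f α β p = -Complex.I * ∑ μ, (frameMatrix γ E.Z p)⁻¹ μ β *
      leviHerm γ p (antiPart (fderiv ℝ Y p) (E.Z μ p)) (E.Z α p) := by
  have hF := E.isAdaptedFrame hM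
  have hV := hM.subset hp.1
  have hpU : p ∈ E.U ∩ V := ⟨hp.2, hV⟩
  have h1 : ∑ μ, (frameMatrix γ E.Z p)⁻¹ μ β * ∑ ν, E.h p ν α * E.A ν μ p = E.A β α p := by
    have h2 := hF.sum_inv_mul_leviHerm hM ⟨hp.1, hpU⟩ β (∑ ν, E.A ν α p • E.Z ν p)
    rw [map_sum, map_sum] at h2
    simp only [sum_apply, hM.leviHerm_smul_left hV, hF.θ_smul hpU, E.θ_Z _ _ p hp.2, mul_ite,
      mul_one, mul_zero, Finset.sum_ite_eq, Finset.mem_univ, if_true] at h2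
    rw [← h2]
    refine Finset.sum_congr rfl fun μ _ => ?_
    rw [E.sum_h_mul_A_symm hM hp]
    simp only [E.h_eq hM hp]
    congr 1
    exact Finset.sum_congr rfl fun ν _ => mul_comm _ _
  rw [DJ, ← h1, Finset.mul_sum, Finset.mul_sum, Finset.sum_mul, ← Finset.sum_sub_distrib]
  refine Finset.sum_congr rfl fun μ _ => ?_
  rw [E.cov2_eq hM hp hY hf, hInv, E.h_eq_frameMatrix hM hp]
  ring

/-- By `DJ_eq` the components of `𝔇_J f` are those of the `ker θ` part of `∂̄_b Y_f`, and the part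
of `∂̄_b Y_f` along `iζ` vanishes for every `f`. -/
theorem DJ_eq_zero_iff {p : Cn n} (hp : p ∈ M ∩ E.U) {f : Cn n → ℂ} {Y : Cn n → Cn n}
    (hY : DifferentiableAt ℝ Y p) (hf : ∀ᶠ q in 𝓝 p, q ∈ M → IsContactLift M γ f q (Y q)) :
    (∀ α β, E.DJ f α β p = 0) ↔
      ∀ w, contactForm γ p w = 0 → antiPart (fderiv ℝ Y p) w = 0 := by
  have hF := E.isAdaptedFrame hM
  have hV := hM.subset hp.1
  have hpU : p ∈ E.U ∩ V := ⟨hp.2, hV⟩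
  constructor
  · intro h
    have hZ : ∀ μ, antiPart (fderiv ℝ Y p) (E.Z μ p) = 0 := by
      intro μ
      set x := antiPart (fderiv ℝ Y p) (E.Z μ p) with hx
      have h0 : contactForm γ p x = 0 := by
        have h1 := contactForm_antiPart_fderiv hM hp.1 hY (hf.mono fun q h hq => (h hq).1)
          (E.contactForm_Z μ p hp.2)
        rw [(hf.self_of_nhds hp.1).2 _ (E.contactForm_Z μ p hp.2)] at h1
        linear_combination -h1 + dbar M f p (E.Z μ p) * Complex.I_mul_I
      have h2 : ∀ α, leviHerm γ p x (E.Z α p) = 0 := by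
        intro α
        have h3 := hF.sum_mul_sum_inv hM ⟨hp.1, hpU⟩ μ
          (fun μ => leviHerm γ p (antiPart (fderiv ℝ Y p) (E.Z μ p)) (E.Z α p))
        rw [← hx] at h3
        rw [← h3]
        refine Finset.sum_eq_zero fun β _ => ?_
        have h4 := h α β
        rw [E.DJ_eq hM hp hY hf, mul_eq_zero] at h4
        rw [h4.resolve_left (by simp), mul_zero]
      refine hM.eq_zero_of_leviHerm_self hp.1 h0 ?_
      rw [hF.eq_sum_of_contactForm_eq_zero hpU h0, map_sum,
        ← hF.eq_sum_of_contactForm_eq_zero hpU h0]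
      exact Finset.sum_eq_zero fun α _ => by rw [leviHerm_smul_right, h2, mul_zero]
    intro w hw
    rw [hF.eq_sum_of_contactForm_eq_zero hpU hw, map_sum]
    exact Finset.sum_eq_zero fun α _ => by rw [antiPart_smul, hZ, smul_zero]
  · intro h α β
    rw [E.DJ_eq hM hp hY hf]
    simp [h _ (E.contactForm_Z _ p hp.2)]

end LocalFrame
end PseudoHermitian

namespace PseudoHermitian
open Filter Topology

variable {n : ℕ} {M V : Set (Cn n)} {γ : Cn n → ℝ}

/-! ### Smooth dependence of `Y_f` on `f` -/

section LiftOperator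

theorem eq_sum_single (v : Cn n) : v = ∑ j, v j • EuclideanSpace.single j (1 : ℂ) := by
  ext i
  simp [Finset.sum_apply, Pi.single_apply]

/-- The complex gradient of `γ` up to a factor: the vector with coordinates the conjugates of those
of `θ`. -/
def gradVec (γ : Cn n → ℝ) (q : Cn n) : Cn n :=
  ∑ j, (starRingEnd ℂ) (contactForm γ q (EuclideanSpace.single j 1)) •
    EuclideanSpace.single j (1 : ℂ)

/-- The projection along `gradVec` onto the kernel of `θ`, multiplied by `θ(gradVec)`. -/
def kerProj (γ : Cn n → ℝ) (q w : Cn n) : Cn n :=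
  contactForm γ q (gradVec γ q) • w - contactForm γ q w • gradVec γ q

theorem contactForm_gradVec_ne_zero {p : Cn n} (h : contactForm γ p ≠ 0) :
    contactForm γ p (gradVec γ p) ≠ 0 := by
  intro h0
  apply h
  have h1 : contactForm γ p (gradVec γ p) =
      ((∑ j, Complex.normSq (contactForm γ p (EuclideanSpace.single j 1)) : ℝ) : ℂ) := by
    rw [gradVec, map_sum]
    push_cast
    refine Finset.sum_congr rfl fun j _ => ?_
    rw [contactForm_smul, mul_comm, Complex.mul_conj]
  rw [h1, Complex.ofReal_eq_zero,
    Finset.sum_eq_zero_iff_of_nonneg fun _ _ => Complex.normSq_nonneg _] at h0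
  ext v
  rw [eq_sum_single v, map_sum]
  refine Finset.sum_eq_zero fun j _ => ?_
  rw [contactForm_smul, Complex.normSq_eq_zero.1 (h0 j (Finset.mem_univ j)), mul_zero]

/-- The operator `y ↦ Q(y, ·)`, in coordinates, of the sesquilinear form
`Q(y, w) = L(y, πw) + θ(y) θ̄(w)` with `π = kerProj`. -/
def liftMatrix (γ : Cn n → ℝ) (q : Cn n) : Cn n →L[ℝ] Cn n :=
  ∑ j, ((leviHerm γ q).flip (kerProj γ q (EuclideanSpace.single j 1))
    + (starRingEnd ℂ) (contactForm γ q (EuclideanSpace.single j 1)) • contactForm γ q).smulRight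
      (EuclideanSpace.single j (1 : ℂ))

/-- The contribution of the value `f(q)` to the right-hand side of the equation for `Y_f(q)`. -/
def liftRhs₀ (γ : Cn n → ℝ) (q : Cn n) : ℂ →L[ℝ] Cn n :=
  ∑ j, ((starRingEnd ℂ) (contactForm γ q (EuclideanSpace.single j 1)) •
    ContinuousLinearMap.id ℝ ℂ).smulRight (EuclideanSpace.single j (1 : ℂ))

/-- The contribution of the derivative of `f` at `q` to the right-hand side of the equation for
`Y_f(q)`. -/
def liftRhs₁ (γ : Cn n → ℝ) (q : Cn n) : (Cn n →L[ℝ] ℂ) →L[ℝ] Cn n :=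
  ∑ j, ((Complex.I * (1 / 2)) •
    (ContinuousLinearMap.apply ℝ ℂ (kerProj γ q (EuclideanSpace.single j 1))
      + Complex.I • ContinuousLinearMap.apply ℝ ℂ
        (Complex.I • kerProj γ q (EuclideanSpace.single j 1)))).smulRight
      (EuclideanSpace.single j (1 : ℂ))

theorem liftMatrix_apply (q y : Cn n) : liftMatrix γ q y =
    ∑ j, (leviHerm γ q y (kerProj γ q (EuclideanSpace.single j 1))
      + (starRingEnd ℂ) (contactForm γ q (EuclideanSpace.single j 1)) * contactForm γ q y) •
        EuclideanSpace.single j (1 : ℂ) := by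
  simp [liftMatrix]

theorem liftRhs₀_apply (q : Cn n) (c : ℂ) : liftRhs₀ γ q c =
    ∑ j, ((starRingEnd ℂ) (contactForm γ q (EuclideanSpace.single j 1)) * c) •
      EuclideanSpace.single j (1 : ℂ) := by
  simp [liftRhs₀]

theorem liftRhs₁_apply (q : Cn n) (a : Cn n →L[ℝ] ℂ) : liftRhs₁ γ q a =
    ∑ j, (Complex.I * antiPart a (kerProj γ q (EuclideanSpace.single j 1))) •
      EuclideanSpace.single j (1 : ℂ) := by
  simp only [liftRhs₁, sum_apply, ContinuousLinearMap.smulRight_apply, smul_apply, add_apply,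
    ContinuousLinearMap.apply_apply, antiPart_apply, smul_eq_mul, mul_assoc]

/-- A solution of the linear system with matrix `liftMatrix` has the properties that define `Y_f`.
-/
theorem lift_of_liftMatrix_eq {p : Cn n} (h : contactForm γ p ≠ 0) {y : Cn n} {c : ℂ}
    {a : Cn n →L[ℝ] ℂ} (hy : liftMatrix γ p y = liftRhs₀ γ p c + liftRhs₁ γ p a) :
    contactForm γ p y = c ∧
      ∀ w, contactForm γ p w = 0 → leviHerm γ p y w = Complex.I * antiPart a w := by
  have hP := contactForm_gradVec_ne_zero h
  rw [liftMatrix_apply, liftRhs₀_apply, liftRhs₁_apply, ← Finset.sum_add_distrib] at hy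
  have h1 : ∀ j, leviHerm γ p y (kerProj γ p (EuclideanSpace.single j 1))
      + (starRingEnd ℂ) (contactForm γ p (EuclideanSpace.single j 1)) * contactForm γ p y =
      (starRingEnd ℂ) (contactForm γ p (EuclideanSpace.single j 1)) * c
      + Complex.I * antiPart a (kerProj γ p (EuclideanSpace.single j 1)) := by
    intro j
    have := congrArg (fun v : Cn n => v j) hy
    simpa [Finset.sum_apply, Pi.single_apply, Finset.sum_add_distrib] using this
  have hk : ∀ w, kerProj γ p w = ∑ j, w j • kerProj γ p (EuclideanSpace.single j 1) := by
    intro w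
    have hw : contactForm γ p w = ∑ j, w j * contactForm γ p (EuclideanSpace.single j 1) := by
      conv_lhs => rw [eq_sum_single w, map_sum]
      simp only [contactForm_smul]
    simp only [kerProj, smul_sub, Finset.sum_sub_distrib, smul_smul]
    rw [← Finset.sum_smul, ← hw]
    congr 1
    conv_lhs => rw [eq_sum_single w, Finset.smul_sum]
    simp only [smul_smul, mul_comm]
  have h2 : ∀ w, leviHerm γ p y (kerProj γ p w)
      + (starRingEnd ℂ) (contactForm γ p w) * contactForm γ p y =
      (starRingEnd ℂ) (contactForm γ p w) * c + Complex.I * antiPart a (kerProj γ p w) := by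
    intro w
    have hw : (starRingEnd ℂ) (contactForm γ p w) =
        ∑ j, (starRingEnd ℂ) (w j) *
          (starRingEnd ℂ) (contactForm γ p (EuclideanSpace.single j 1)) := by
      conv_lhs => rw [eq_sum_single w, map_sum, map_sum]
      simp only [contactForm_smul, map_mul]
    rw [hk w, hw, map_sum, map_sum, Finset.sum_mul, Finset.sum_mul, Finset.mul_sum,
      ← Finset.sum_add_distrib, ← Finset.sum_add_distrib]
    refine Finset.sum_congr rfl fun j _ => ?_
    rw [leviHerm_smul_right, antiPart_smul, smul_eq_mul]
    linear_combination (starRingEnd ℂ) (w j) * h1 j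
  have hconj : (starRingEnd ℂ) (contactForm γ p (gradVec γ p)) ≠ 0 :=
    (map_ne_zero (starRingEnd ℂ)).2 hP
  -- test with `w = gradVec`, where `kerProj` vanishes, and with `w ∈ ker θ`
  refine ⟨?_, fun w hw => ?_⟩
  · have h3 := h2 (gradVec γ p)
    rw [show kerProj γ p (gradVec γ p) = 0 from sub_self _, map_zero, map_zero, mul_zero, zero_add,
      add_zero] at h3
    exact mul_left_cancel₀ hconj h3
  · have h3 := h2 w
    rw [show kerProj γ p w = contactForm γ p (gradVec γ p) • w by simp [kerProj, hw], hw, map_zero,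
      zero_mul, zero_mul, add_zero, zero_add, leviHerm_smul_right, antiPart_smul, smul_eq_mul,
      mul_left_comm] at h3
    exact mul_left_cancel₀ hconj h3

variable (hM : IsLeviHypersurface M V γ)
include hM

namespace IsLeviHypersurface

theorem contDiffOn_contactForm_apply (v : Cn n) :
    ContDiffOn ℝ ∞ (fun q => contactForm γ q v) V :=
  hM.contDiffOn_contactForm.clm_apply contDiffOn_const

theorem contDiffOn_conj_contactForm_apply (v : Cn n) :
    ContDiffOn ℝ ∞ (fun q => (starRingEnd ℂ) (contactForm γ q v)) V :=
  (Complex.conjCLE : ℂ →L[ℝ] ℂ).contDiff.comp_contDiffOn (hM.contDiffOn_contactForm_apply v)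

theorem contDiffOn_kerProj (w : Cn n) : ContDiffOn ℝ ∞ (fun q => kerProj γ q w) V := by
  have h1 : ContDiffOn ℝ ∞ (gradVec γ) V :=
    ContDiffOn.sum fun j _ => (hM.contDiffOn_conj_contactForm_apply _).smul contDiffOn_const
  exact ((hM.contDiffOn_contactForm.clm_apply h1).smul contDiffOn_const).sub
    ((hM.contDiffOn_contactForm_apply w).smul h1)

theorem contDiffOn_liftMatrix : ContDiffOn ℝ ∞ (liftMatrix γ) V := by
  rw [contDiffOn_clm_apply]
  intro y
  simp only [liftMatrix_apply]
  refine ContDiffOn.sum fun j _ => ?_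
  have h := ((hM.contDiffOn_leviHerm.clm_apply (contDiffOn_const (c := y))).clm_apply
    (hM.contDiffOn_kerProj (EuclideanSpace.single j 1))).add
      ((hM.contDiffOn_conj_contactForm_apply (EuclideanSpace.single j 1)).mul
      (hM.contDiffOn_contactForm_apply y))
  exact h.smul contDiffOn_const

theorem contDiffOn_liftRhs₀ : ContDiffOn ℝ ∞ (liftRhs₀ γ) V := by
  rw [contDiffOn_clm_apply]
  intro c
  simp only [liftRhs₀_apply]
  exact ContDiffOn.sum fun j _ =>
    ((hM.contDiffOn_conj_contactForm_apply _).mul contDiffOn_const).smul contDiffOn_const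

theorem contDiffOn_liftRhs₁ : ContDiffOn ℝ ∞ (liftRhs₁ γ) V := by
  rw [contDiffOn_clm_apply]
  intro a
  simp only [liftRhs₁_apply]
  exact ContDiffOn.sum fun j _ => (contDiffOn_const.mul
    ((antiPart a).contDiff.comp_contDiffOn (hM.contDiffOn_kerProj _))).smul contDiffOn_const

/-- `Y_f` is given by a smooth first order differential operator applied to any extension of `f`. -/
theorem exists_lift_operator : ∃ (W₀ : Set (Cn n)) (S₀ : Cn n → (ℂ →L[ℝ] Cn n))
    (S₁ : Cn n → ((Cn n →L[ℝ] ℂ) →L[ℝ] Cn n)), IsOpen W₀ ∧ M ⊆ W₀ ∧ ContDiffOn ℝ ∞ S₀ W₀ ∧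
      ContDiffOn ℝ ∞ S₁ W₀ ∧ ∀ p ∈ M, ∀ (c : ℂ) (a : Cn n →L[ℝ] ℂ),
        contactForm γ p (S₀ p c + S₁ p a) = c ∧ ∀ w, contactForm γ p w = 0 →
          leviHerm γ p (S₀ p c + S₁ p a) w = Complex.I * antiPart a w := by
  obtain ⟨W₀, hW₀⟩ : ∃ W₀ : Set (Cn n), W₀ = V ∩
    liftMatrix γ ⁻¹' Set.range ((↑) : (Cn n ≃L[ℝ] Cn n) → (Cn n →L[ℝ] Cn n)) := ⟨_, rfl⟩
  have ho : IsOpen W₀ := by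
    rw [hW₀]
    exact hM.contDiffOn_liftMatrix.continuousOn.isOpen_inter_preimage hM.isOpen
      ContinuousLinearEquiv.isOpen
  have hWV : W₀ ⊆ V := by
    rw [hW₀]
    exact Set.inter_subset_left
  have hequiv : ∀ q ∈ W₀, ∃ e : Cn n ≃L[ℝ] Cn n, (e : Cn n →L[ℝ] Cn n) = liftMatrix γ q := by
    intro q hq
    rw [hW₀] at hq
    exact hq.2
  have hMW : M ⊆ W₀ := by
    intro p hp
    rw [hW₀]
    refine ⟨hM.subset hp, ?_⟩
    have hinj : Function.Injective (liftMatrix γ p : Cn n →ₗ[ℝ] Cn n) := by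
      refine LinearMap.ker_eq_bot.1 (LinearMap.ker_eq_bot'.2 fun y hy => ?_)
      have h := lift_of_liftMatrix_eq (contactForm_ne_zero (hM.regular p hp)) (y := y) (c := 0)
        (a := 0) (by rw [map_zero, map_zero, add_zero]; exact hy)
      refine hM.eq_zero_of_leviHerm_self hp h.1 ?_
      rw [h.2 y h.1]
      simp [antiPart_apply]
    exact ⟨(LinearEquiv.ofInjectiveEndo _ hinj).toContinuousLinearEquiv, by ext v; rfl⟩
  have hinv : ContDiffOn ℝ ∞ (fun q => (liftMatrix γ q).inverse) W₀ := by
    intro q hq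
    obtain ⟨e, he⟩ := hequiv q hq
    have h := contDiffAt_map_inverse (n := ∞) e
    rw [he] at h
    exact h.comp_contDiffWithinAt q ((hM.contDiffOn_liftMatrix.mono hWV) q hq)
  refine ⟨W₀, fun q => (liftMatrix γ q).inverse.comp (liftRhs₀ γ q),
    fun q => (liftMatrix γ q).inverse.comp (liftRhs₁ γ q), ho, hMW,
    hinv.clm_comp (hM.contDiffOn_liftRhs₀.mono hWV),
    hinv.clm_comp (hM.contDiffOn_liftRhs₁.mono hWV), fun p hp c a => ?_⟩
  refine lift_of_liftMatrix_eq (contactForm_ne_zero (hM.regular p hp)) ?_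
  obtain ⟨e, he⟩ := hequiv p (hMW hp)
  change liftMatrix γ p ((liftMatrix γ p).inverse _ + (liftMatrix γ p).inverse _) = _
  rw [← he]
  simp

end IsLeviHypersurface
end LiftOperator

/-! ### Bounds in the `C^k` norms -/

theorem exists_norm_iteratedFDeriv_clm_apply_le {E F G : Type*} [NormedAddCommGroup E]
    [NormedSpace ℝ E] [NormedAddCommGroup F] [NormedSpace ℝ F] [NormedAddCommGroup G]
    [NormedSpace ℝ G] {M W₀ : Set E} (hM : IsCompact M) (hW₀ : IsOpen W₀) (hMW : M ⊆ W₀)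
    {A : E → F →L[ℝ] G} (hA : ContDiffOn ℝ ∞ A W₀) (k : ℕ) :
    ∃ C : ℝ, 0 < C ∧ ∀ (W : Set E) (x : E → F) (η : ℝ), IsOpen W → M ⊆ W → ContDiffOn ℝ ∞ x W →
      (∀ q ∈ M, ∀ j ≤ k, ‖iteratedFDeriv ℝ j x q‖ ≤ η) →
      ∀ q ∈ M, ∀ j ≤ k, ‖iteratedFDeriv ℝ j (fun q => A q (x q)) q‖ ≤ C * η := by
  have hb : ∀ i : ℕ, ∃ B : ℝ, ∀ q ∈ M, ‖iteratedFDeriv ℝ i A q‖ ≤ B := by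
    intro i
    have hc : ContinuousOn (iteratedFDerivWithin ℝ i A W₀) M :=
      (hA.continuousOn_iteratedFDerivWithin (by exact_mod_cast le_top) hW₀.uniqueDiffOn).mono hMW
    obtain ⟨B, hB⟩ := hM.exists_bound_of_continuousOn hc
    refine ⟨B, fun q hq => ?_⟩
    rw [← iteratedFDerivWithin_of_isOpen i hW₀ (hMW hq)]
    exact hB q hq
  choose B hB using hb
  refine ⟨2 ^ k * (1 + ∑ i ∈ Finset.range (k + 1), |B i|), by positivity, ?_⟩
  intro W x η hW hMW' hx hη q hq j hj
  have hqW : q ∈ W₀ ∩ W := ⟨hMW hq, hMW' hq⟩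
  have ho := hW₀.inter hW
  have h := norm_iteratedFDerivWithin_clm_apply (hA.mono Set.inter_subset_left)
    (hx.mono Set.inter_subset_right) ho.uniqueDiffOn hqW (n := j) (by exact_mod_cast le_top)
  rw [iteratedFDerivWithin_of_isOpen j ho hqW] at h
  refine h.trans ?_
  have hη0 : 0 ≤ η := (norm_nonneg _).trans (hη q hq 0 (Nat.zero_le _))
  calc ∑ i ∈ Finset.range (j + 1), (j.choose i : ℝ) *
        ‖iteratedFDerivWithin ℝ i A (W₀ ∩ W) q‖ * ‖iteratedFDerivWithin ℝ (j - i) x (W₀ ∩ W) q‖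
      ≤ ∑ i ∈ Finset.range (j + 1), (j.choose i : ℝ) *
        (1 + ∑ i ∈ Finset.range (k + 1), |B i|) * η := by
        refine Finset.sum_le_sum fun i hi => ?_
        rw [iteratedFDerivWithin_of_isOpen i ho hqW, iteratedFDerivWithin_of_isOpen (j - i) ho hqW]
        have hik : i ∈ Finset.range (k + 1) := by
          rw [Finset.mem_range] at hi ⊢
          omega
        have h1 : ‖iteratedFDeriv ℝ i A q‖ ≤ 1 + ∑ i ∈ Finset.range (k + 1), |B i| := by
          have := Finset.single_le_sum (f := fun i => |B i|) (fun _ _ => abs_nonneg _) hik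
          linarith [hB i q hq, le_abs_self (B i)]
        exact mul_le_mul (mul_le_mul_of_nonneg_left h1 (by positivity))
          (hη q hq _ ((Nat.sub_le _ _).trans hj)) (norm_nonneg _) (by positivity)
    _ = 2 ^ j * (1 + ∑ i ∈ Finset.range (k + 1), |B i|) * η := by
        rw [← Finset.sum_mul, ← Finset.sum_mul]
        congr 2
        exact_mod_cast Nat.sum_range_choose j
    _ ≤ 2 ^ k * (1 + ∑ i ∈ Finset.range (k + 1), |B i|) * η := by
        gcongr
        norm_num

end PseudoHermitian

namespace PseudoHermitian
open Filter Topology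

variable {n : ℕ} {M V : Set (Cn n)} {γ : Cn n → ℝ}

/-! ### The bijection with the CR maps -/

theorem ext0_apply {F : Type} [NormedAddCommGroup F] (f : M → F) (p : M) : ext0 M f p = f p :=
  Subtype.val_injective.extend_apply f 0 p

theorem ext0_of_mem {F : Type} [NormedAddCommGroup F] (f : M → F) {p : Cn n} (hp : p ∈ M) :
    ext0 M f p = f ⟨p, hp⟩ := ext0_apply f ⟨p, hp⟩

theorem contDiffOn_of_extension {W₀ W : Set (Cn n)} {S₀ : Cn n → (ℂ →L[ℝ] Cn n)}
    {S₁ : Cn n → ((Cn n →L[ℝ] ℂ) →L[ℝ] Cn n)} (h₀ : ContDiffOn ℝ ∞ S₀ W₀)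
    (h₁ : ContDiffOn ℝ ∞ S₁ W₀) (hW : IsOpen W) {g : Cn n → ℂ} (hg : ContDiffOn ℝ ∞ g W) :
    ContDiffOn ℝ ∞ (fun q => S₀ q (g q) + S₁ q (fderiv ℝ g q)) (W₀ ∩ W) :=
  ((h₀.mono Set.inter_subset_left).clm_apply (hg.mono Set.inter_subset_right)).add
    ((h₁.mono Set.inter_subset_left).clm_apply
      ((hg.fderiv_of_isOpen hW (by simp)).mono Set.inter_subset_right))

namespace IsLeviHypersurface

variable (hM : IsLeviHypersurface M V γ)
include hM

theorem contactForm_contactField (f : M → ℂ) (p : M) :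
    contactForm γ p (contactField M γ f p) = f p := by
  rw [(hM.isContactLift_contactField f p).1, ext0_apply]

/-- An extension `g` of `f` gives the extension `S₀ g + S₁ dg` of `Y_f`. -/
theorem isContactLift_of_extension {S₀ : Cn n → (ℂ →L[ℝ] Cn n)}
    {S₁ : Cn n → ((Cn n →L[ℝ] ℂ) →L[ℝ] Cn n)}
    (hS : ∀ p ∈ M, ∀ (c : ℂ) (a : Cn n →L[ℝ] ℂ),
        contactForm γ p (S₀ p c + S₁ p a) = c ∧ ∀ w, contactForm γ p w = 0 →
          leviHerm γ p (S₀ p c + S₁ p a) w = Complex.I * antiPart a w)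
    {f : M → ℂ} {W : Set (Cn n)} (hW : IsOpen W) {g : Cn n → ℂ} (hg : ContDiffOn ℝ ∞ g W)
    (hgf : ∀ q : M, (q : Cn n) ∈ W → g q = f q) {p : Cn n} (hp : p ∈ M) (hpW : p ∈ W) :
    IsContactLift M γ (ext0 M f) p (S₀ p (g p) + S₁ p (fderiv ℝ g p)) := by
  obtain ⟨h1, h2⟩ := hS p hp (g p) (fderiv ℝ g p)
  refine ⟨by rw [h1, ext0_of_mem f hp, hgf ⟨p, hp⟩ hpW], fun w hw => ?_⟩
  have hd : DifferentiableAt ℝ g p :=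
    (hg.contDiffAt (hW.mem_nhds hpW)).differentiableAt (by simp)
  have he : ∀ᶠ q in 𝓝 p, q ∈ M → ext0 M f q = g q := by
    filter_upwards [hW.mem_nhds hpW] with q hq hqM
    rw [ext0_of_mem f hqM, hgf ⟨q, hqM⟩ hq]
  rw [h2 w hw, dbar, hM.tderiv_eq hp hd he (mem_tangent_of_contactForm_eq_zero hw),
    hM.tderiv_eq hp hd he (mem_tangent_of_contactForm_eq_zero
      (by rw [contactForm_smul, hw, mul_zero]))]
  rfl

theorem mapsTo_chi : Set.MapsTo (chi M γ) (kerDJ M γ) (CRMaps M γ) := by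
  obtain ⟨W₀, S₀, S₁, hW₀, hMW₀, h₀, h₁, hS⟩ := hM.exists_lift_operator
  rintro f ⟨hfs, hfk⟩
  have key : ∀ p : M, ∃ W : Set (Cn n), IsOpen W ∧ (p : Cn n) ∈ W ∧ ∃ Y : Cn n → Cn n,
      ContDiffOn ℝ ∞ Y W ∧ ∀ q ∈ M, q ∈ W → IsContactLift M γ (ext0 M f) q (Y q) := by
    intro p
    obtain ⟨W, hW, hpW, g, hg, hgf⟩ := hfs p
    exact ⟨W₀ ∩ W, hW₀.inter hW, ⟨hMW₀ p.2, hpW⟩, _, contDiffOn_of_extension h₀ h₁ hW hg,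
      fun q hq hqW => hM.isContactLift_of_extension hS hW hg hgf hq hqW.2⟩
  have hY : ∀ {W : Set (Cn n)} {Y : Cn n → Cn n},
      (∀ q ∈ M, q ∈ W → IsContactLift M γ (ext0 M f) q (Y q)) →
      ∀ q : M, (q : Cn n) ∈ W → (q : Cn n) + Y q = chi M γ f q := by
    intro W Y h q hq
    rw [chi, (h q q.2 hq).eq hM q.2 (hM.isContactLift_contactField f q)]
  refine ⟨fun p => ?_, fun p hp v hv => ?_⟩
  · obtain ⟨W, hW, hpW, Y, hYs, hYl⟩ := key p
    exact ⟨W, hW, hpW, fun q => q + Y q, contDiffOn_id.add hYs, hY hYl⟩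
  · obtain ⟨W, hW, hpW, Y, hYs, hYl⟩ := key ⟨p, hp⟩
    have hYd : DifferentiableAt ℝ Y p :=
      (hYs.contDiffAt (hW.mem_nhds hpW)).differentiableAt (by simp)
    obtain ⟨E, hE⟩ := hM.exists_localFrame hp
    have hv0 := mem_contactSpace_iff.1 hv
    have h1 := (E.DJ_eq_zero_iff hM ⟨hp, hE⟩ hYd (by
      filter_upwards [hW.mem_nhds hpW] with q hq hqM
      exact hYl q hqM hq)).1 (fun α β => hfk E p ⟨hp, hE⟩ α β) v hv0
    have hd : HasFDerivAt (fun q => q + Y q) (ContinuousLinearMap.id ℝ (Cn n) + fderiv ℝ Y p) p :=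
      (hasFDerivAt_id p).add hYd.hasFDerivAt
    have he : ∀ᶠ q in 𝓝 p, q ∈ M → ext0 M (chi M γ f) q = q + Y q := by
      filter_upwards [hW.mem_nhds hpW] with q hq hqM
      rw [ext0_of_mem _ hqM, ← hY hYl ⟨q, hqM⟩ hq]
    rw [hM.tderiv_eq hp hd.differentiableAt he hv.1, hM.tderiv_eq hp hd.differentiableAt he hv.2,
      hd.fderiv, add_apply, add_apply, antiPart_eq_zero_iff.1 h1, smul_add]
    rfl

theorem injective_chi : Function.Injective (chi M γ) := by
  intro f f' h
  funext p
  have h1 : contactField M γ f p = contactField M γ f' p := add_left_cancel (congrFun h p)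
  rw [← hM.contactForm_contactField f p, h1, hM.contactForm_contactField]

/-- A CR map `φ` equals `χ_f` for `f = θ(φ - id)`. -/
theorem mem_kerDJ_and_chi_eq {φ : M → Cn n} (hφ : φ ∈ CRMaps M γ) :
    (fun p : M => contactForm γ p (φ p - p)) ∈ kerDJ M γ ∧
      chi M γ (fun p : M => contactForm γ p (φ p - p)) = φ := by
  obtain ⟨hφs, hφc⟩ := hφ
  set f : M → ℂ := fun p : M => contactForm γ p (φ p - p) with hf
  have key : ∀ p : M, ∃ W : Set (Cn n), IsOpen W ∧ (p : Cn n) ∈ W ∧ ∃ Y : Cn n → Cn n,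
      ContDiffOn ℝ ∞ Y W ∧ (∀ q : M, (q : Cn n) ∈ W → Y q = φ q - q) ∧
      (∀ q ∈ M, q ∈ W → IsContactLift M γ (ext0 M f) q (Y q)) ∧
      (∀ q ∈ M, q ∈ W → ∀ w, contactForm γ q w = 0 → antiPart (fderiv ℝ Y q) w = 0) := by
    intro p
    obtain ⟨W, hW, hpW, g, hg, hgφ⟩ := hφs p
    have hYs : ContDiffOn ℝ ∞ (fun q => g q - q) W := hg.sub contDiffOn_id
    have hd : ∀ q ∈ W, DifferentiableAt ℝ g q := fun q hq =>
      (hg.contDiffAt (hW.mem_nhds hq)).differentiableAt (by simp)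
    have hcr : ∀ q ∈ M, q ∈ W → ∀ w, contactForm γ q w = 0 →
        antiPart (fderiv ℝ (fun q => g q - q) q) w = 0 := by
      intro q hq hqW w hw
      have hwc := mem_contactSpace_iff.2 hw
      have he : ∀ᶠ x in 𝓝 q, x ∈ M → ext0 M φ x = g x := by
        filter_upwards [hW.mem_nhds hqW] with x hx hxM
        rw [ext0_of_mem _ hxM, hgφ ⟨x, hxM⟩ hx]
      have h1 := hφc q hq w hwc
      rw [hM.tderiv_eq hq (hd q hqW) he hwc.1, hM.tderiv_eq hq (hd q hqW) he hwc.2] at h1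
      apply antiPart_eq_zero
      have hsub : fderiv ℝ (fun q => g q - q) q = fderiv ℝ g q - ContinuousLinearMap.id ℝ (Cn n) :=
        ((hd q hqW).hasFDerivAt.sub (hasFDerivAt_id q)).fderiv
      rw [hsub, sub_apply, sub_apply, h1, smul_sub]
      rfl
    refine ⟨W, hW, hpW, fun q => g q - q, hYs, fun q hq => by simp only [hgφ q hq], ?_, hcr⟩
    intro q hq hqW
    have h0 : ∀ x : M, (x : Cn n) ∈ W → contactForm γ x (g x - x) = ext0 M f x := by
      intro x hx
      rw [ext0_apply, hgφ x hx]
    refine ⟨h0 ⟨q, hq⟩ hqW, fun w hw => ?_⟩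
    have h1 := contactForm_antiPart_fderiv hM hq (Y := fun q => g q - q) (f := ext0 M f)
      ((hYs.contDiffAt (hW.mem_nhds hqW)).differentiableAt (by simp)) (by
        filter_upwards [hW.mem_nhds hqW] with x hx hxM
        exact h0 ⟨x, hxM⟩ hx) hw
    rw [hcr q hq hqW w hw, map_zero, add_zero] at h1
    rw [h1, ← mul_assoc, mul_neg, Complex.I_mul_I, neg_neg, one_mul]
  refine ⟨⟨fun p => ?_, fun E p hp α β => ?_⟩, ?_⟩
  · obtain ⟨W, hW, hpW, Y, hYs, hYφ, -, -⟩ := key p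
    refine ⟨W ∩ V, hW.inter hM.isOpen, ⟨hpW, hM.subset p.2⟩, fun q => contactForm γ q (Y q),
      (hM.contDiffOn_contactForm.mono Set.inter_subset_right).clm_apply
        (hYs.mono Set.inter_subset_left), fun q hq => ?_⟩
    simp only [hYφ q hq.1, hf]
  · obtain ⟨W, hW, hpW, Y, hYs, -, hYl, hcr⟩ := key ⟨p, hp.1⟩
    refine (E.DJ_eq_zero_iff hM hp
      ((hYs.contDiffAt (hW.mem_nhds hpW)).differentiableAt (by simp)) ?_).2
      (hcr p hp.1 hpW) α β
    filter_upwards [hW.mem_nhds hpW] with q hq hqM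
    exact hYl q hqM hq
  · funext p
    obtain ⟨W, hW, hpW, Y, hYs, hYφ, hYl, -⟩ := key p
    rw [chi, ← (hYl p p.2 hpW).eq hM p.2 (hM.isContactLift_contactField f p), hYφ p hpW]
    abel

theorem bijOn_chi : Set.BijOn (chi M γ) (kerDJ M γ) (CRMaps M γ) :=
  ⟨hM.mapsTo_chi, hM.injective_chi.injOn, fun _ hφ => ⟨_, hM.mem_kerDJ_and_chi_eq hφ⟩⟩

/-! ### Small functions and embeddings -/

theorem exists_extension_small (k : ℕ) {ε : ℝ} (hε : 0 < ε) : ∃ (l : ℕ) (δ : ℝ), 0 < δ ∧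
    ∀ f : M → ℂ, IsCkSmall M l δ f → ∃ (W : Set (Cn n)) (Y : Cn n → Cn n), IsOpen W ∧ M ⊆ W ∧
      ContDiffOn ℝ ∞ Y W ∧ (∀ q : M, Y q = contactField M γ f q) ∧
      ∀ q ∈ M, ∀ j ≤ k, ‖iteratedFDeriv ℝ j Y q‖ < ε := by
  obtain ⟨W₀, S₀, S₁, hW₀, hMW₀, h₀, h₁, hS⟩ := hM.exists_lift_operator
  obtain ⟨C₀, hC₀, hb₀⟩ := exists_norm_iteratedFDeriv_clm_apply_le hM.isCompact hW₀ hMW₀ h₀ k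
  obtain ⟨C₁, hC₁, hb₁⟩ := exists_norm_iteratedFDeriv_clm_apply_le hM.isCompact hW₀ hMW₀ h₁ k
  refine ⟨k + 1, ε / (2 * (C₀ + C₁)), by positivity, ?_⟩
  rintro f ⟨W, hW, hMW, g, hg, hgf, hsmall⟩
  have hg' : ContDiffOn ℝ ∞ (fderiv ℝ g) W := hg.fderiv_of_isOpen hW (by simp)
  refine ⟨W₀ ∩ W, _, hW₀.inter hW, fun q hq => ⟨hMW₀ hq, hMW hq⟩,
    contDiffOn_of_extension h₀ h₁ hW hg, fun q => ?_, fun q hq j hj => ?_⟩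
  · exact (hM.isContactLift_of_extension hS hW hg (fun q _ => hgf q) q.2 (hMW q.2)).eq hM q.2
      (hM.isContactLift_contactField f q)
  · have hqW : q ∈ W₀ ∩ W := ⟨hMW₀ hq, hMW hq⟩
    have hn := (hW₀.inter hW).mem_nhds hqW
    have e₀ := hb₀ W g _ hW hMW hg
      (fun q hq j hj => (hsmall ⟨q, hq⟩ j (hj.trans (Nat.le_succ k))).le) q hq j hj
    have e₁ := hb₁ W (fderiv ℝ g) _ hW hMW hg' (fun q hq j hj => by
      rw [norm_iteratedFDeriv_fderiv]
      exact (hsmall ⟨q, hq⟩ (j + 1) (Nat.succ_le_succ hj)).le) q hq j hj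
    have c₀ : ContDiffAt ℝ j (fun q => S₀ q (g q)) q :=
      (((h₀.mono Set.inter_subset_left).clm_apply
        (hg.mono Set.inter_subset_right)).contDiffAt hn).of_le (by exact_mod_cast le_top)
    have c₁ : ContDiffAt ℝ j (fun q => S₁ q (fderiv ℝ g q)) q :=
      (((h₁.mono Set.inter_subset_left).clm_apply
        (hg'.mono Set.inter_subset_right)).contDiffAt hn).of_le (by exact_mod_cast le_top)
    have hadd := iteratedFDeriv_add_apply c₀ c₁
    change ‖iteratedFDeriv ℝ j ((fun q => S₀ q (g q)) + fun q => S₁ q (fderiv ℝ g q)) q‖ < ε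
    rw [hadd]
    calc _ ≤ C₀ * (ε / (2 * (C₀ + C₁))) + C₁ * (ε / (2 * (C₀ + C₁))) :=
          (norm_add_le _ _).trans (add_le_add e₀ e₁)
      _ = ε / 2 := by field_simp
      _ < ε := half_lt_self hε

/-- There is a bound such that `id + Y` is an embedding of `M` as soon as `Y` and its first
derivatives are below it on `M`. -/
theorem exists_embedding_bound : ∃ ε : ℝ, 0 < ε ∧ ∀ φ ∈ CRMaps M γ,
    ∀ (W : Set (Cn n)) (Y : Cn n → Cn n), IsOpen W → M ⊆ W → ContDiffOn ℝ ∞ Y W →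
      (∀ q : M, φ q = q + Y q) → (∀ q ∈ M, ∀ j ≤ 1, ‖iteratedFDeriv ℝ j Y q‖ < ε) →
      φ ∈ CREmbeddings M γ := by
  obtain ⟨C, hC, hlip⟩ := hM.exists_lipschitz (F := Cn n)
  refine ⟨1 / (C + 1), by positivity, ?_⟩
  intro φ hφ W Y hW hMW hY hφY hsmall
  have hd : ∀ q ∈ M, DifferentiableAt ℝ Y q := fun q hq =>
    (hY.contDiffAt (hW.mem_nhds (hMW hq))).differentiableAt (by simp)
  have h0 : ∀ q ∈ M, ‖Y q‖ ≤ 1 / (C + 1) := fun q hq => by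
    have := hsmall q hq 0 (Nat.zero_le _)
    rw [norm_iteratedFDeriv_zero] at this
    exact this.le
  have h1 : ∀ q ∈ M, ‖fderiv ℝ Y q‖ ≤ 1 / (C + 1) := fun q hq => by
    have := hsmall q hq 1 le_rfl
    rw [norm_iteratedFDeriv_one] at this
    exact this.le
  have hC1 : C * (1 / (C + 1)) < 1 := by
    rw [mul_one_div, div_lt_one (by positivity)]
    linarith
  have hC2 : 1 / (C + 1) < 1 := by
    rw [div_lt_one (by positivity)]
    linarith
  refine ⟨hφ, ?_, fun p hp v hv hv0 => ?_⟩
  · have : CompactSpace M := isCompact_iff_compactSpace.1 hM.isCompact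
    have hcont : Continuous φ := by
      have hYc : Continuous fun q : M => Y q :=
        continuous_iff_continuousAt.2 fun q =>
          (hd q q.2).continuousAt.comp continuous_subtype_val.continuousAt
      have : φ = fun q : M => (q : Cn n) + Y q := funext hφY
      rw [this]
      exact continuous_subtype_val.add hYc
    refine (hcont.isClosedEmbedding fun q q' hqq' => ?_).isEmbedding
    rw [hφY, hφY] at hqq'
    have h2 : ‖(q : Cn n) - q'‖ = ‖Y q - Y q'‖ := by
      rw [← norm_neg (Y q - Y q')]
      congr 1
      rw [neg_sub, sub_eq_sub_iff_add_eq_add, hqq', add_comm]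
    have h3 := hlip Y hd _ h0 h1 q q.2 q' q'.2
    rw [← h2] at h3
    have h4 : ‖(q : Cn n) - q'‖ = 0 := by
      by_contra hne
      have hpos : 0 < ‖(q : Cn n) - q'‖ := lt_of_le_of_ne (norm_nonneg _) (Ne.symm hne)
      have := mul_lt_mul_of_pos_right hC1 hpos
      linarith
    exact Subtype.ext (sub_eq_zero.1 (norm_eq_zero.1 h4))
  · have hdφ : HasFDerivAt (fun q => q + Y q) (ContinuousLinearMap.id ℝ (Cn n) + fderiv ℝ Y p) p :=
      (hasFDerivAt_id p).add (hd p hp).hasFDerivAt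
    have he : ∀ᶠ q in 𝓝 p, q ∈ M → ext0 M φ q = q + Y q :=
      Eventually.of_forall fun q hq => by rw [ext0_of_mem _ hq, hφY]
    rw [hM.tderiv_eq hp hdφ.differentiableAt he hv, hdφ.fderiv, add_apply] at hv0
    have h2 : ‖v‖ ≤ 1 / (C + 1) * ‖v‖ := by
      have h3 : v = -fderiv ℝ Y p v := eq_neg_of_add_eq_zero_left hv0
      calc ‖v‖ = ‖fderiv ℝ Y p v‖ := by conv_lhs => rw [h3, norm_neg]
        _ ≤ ‖fderiv ℝ Y p‖ * ‖v‖ := (fderiv ℝ Y p).le_opNorm v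
        _ ≤ 1 / (C + 1) * ‖v‖ := by gcongr; exact h1 p hp
    by_contra hne
    have := mul_lt_mul_of_pos_right hC2 (norm_pos_iff.2 hne)
    linarith

end IsLeviHypersurface
end PseudoHermitian

end

theorem lemma6p3 (n : ℕ) (Ω V : Set (PseudoHermitian.Cn n)) (γ : PseudoHermitian.Cn n → ℝ)
    (hΩ : PseudoHermitian.IsStronglyPseudoconvex Ω V γ)
    (M : Set (PseudoHermitian.Cn n)) (hM : M = frontier Ω) :
    Set.BijOn (PseudoHermitian.chi M γ) (PseudoHermitian.kerDJ M γ)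
        (PseudoHermitian.CRMaps M γ) ∧
    (∀ (k : ℕ) (ε : ℝ), 0 < ε → ∃ (l : ℕ) (δ : ℝ), 0 < δ ∧
      ∀ f ∈ PseudoHermitian.kerDJ M γ, PseudoHermitian.IsCkSmall M l δ f →
        PseudoHermitian.chi M γ f ∈ PseudoHermitian.CREmbeddings M γ ∧
        PseudoHermitian.IsCkSmall M k ε (fun p => PseudoHermitian.chi M γ f p - p)) ∧
    (∀ (k : ℕ) (ε : ℝ), 0 < ε → ∃ (l : ℕ) (δ : ℝ), 0 < δ ∧
      ∀ φ ∈ PseudoHermitian.CREmbeddings M γ,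
        PseudoHermitian.IsCkSmall M l δ (fun p => φ p - p) →
        ∃ f ∈ PseudoHermitian.kerDJ M γ, PseudoHermitian.IsCkSmall M k ε f ∧
          PseudoHermitian.chi M γ f = φ) := by
  subst hM
  have hL := hΩ.isLeviHypersurface
  refine ⟨hL.bijOn_chi, fun k ε hε => ?_, fun k ε hε => ?_⟩
  · obtain ⟨ε₀, hε₀, hemb⟩ := hL.exists_embedding_bound
    obtain ⟨l, δ, hδ, h⟩ := hL.exists_extension_small (max k 1) (lt_min hε hε₀)
    refine ⟨l, δ, hδ, fun f hf hfs => ?_⟩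
    obtain ⟨W, Y, hW, hMW, hY, hYf, hYs⟩ := h f hfs
    refine ⟨hemb _ (hL.mapsTo_chi hf) W Y hW hMW hY
      (fun q => by rw [hYf, PseudoHermitian.chi]) fun q hq j hj =>
        (hYs q hq j (hj.trans (le_max_right _ _))).trans_le (min_le_right _ _), W, hW, hMW, Y, hY,
      fun q => by simp only [hYf, PseudoHermitian.chi, add_sub_cancel_left], fun q j hj =>
        (hYs q q.2 j (hj.trans (le_max_left _ _))).trans_le (min_le_left _ _)⟩
  · obtain ⟨C, hC, hb⟩ := PseudoHermitian.exists_norm_iteratedFDeriv_clm_apply_le hL.isCompact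
      hL.isOpen hL.subset hL.contDiffOn_contactForm k
    refine ⟨k, ε / (2 * C), by positivity, ?_⟩
    rintro φ hφ ⟨W, hW, hMW, g, hg, hgφ, hs⟩
    obtain ⟨h1, h2⟩ := hL.mem_kerDJ_and_chi_eq hφ.1
    refine ⟨_, h1, ⟨W ∩ V, hW.inter hL.isOpen, fun q hq => ⟨hMW hq, hL.subset hq⟩,
      fun q => PseudoHermitian.contactForm γ q (g q),
      (hL.contDiffOn_contactForm.mono Set.inter_subset_right).clm_apply
        (hg.mono Set.inter_subset_left), fun q => by simp only [hgφ], fun q j hj => ?_⟩, h2⟩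
    have := hb W g _ hW hMW hg (fun q hq j hj => (hs ⟨q, hq⟩ j hj).le) q q.2 j hj
    calc _ ≤ C * (ε / (2 * C)) := this
      _ = ε / 2 := by field_simp
      _ < ε := half_lt_self hε
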